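/- **Jordan–Wigner free-fermion evolution.** Let $J_1,\dots,J_{N-1}$ and $B_1,\dots,B_N$ be real, and let $$H=\tfrac12\sum_{n=1}^{N-1}J_n(X_nX_{n+1}+Y_nY_{n+1})-\sum_{n=1}^N B_nZ_n$$ on $(\mathbb C^2)^{\otimes N}$, where $X,Y,Z$ are the Pauli matrices. Write $\beta=\sum_n B_n$, $|\underline 0\rangle=|0\cdots0\rangle$, $|\underline n\rangle$ for the basis state whose only $|1\rangle$ is at site $n$, and identify $\sum_n a_n|\underline n\rangle$ with $(a_n)\in\mathbb C^N$. Let $H_1$ be the $N\times N$ tridiagonal matrix with diagonal entries $2B_n$ and off-diagonal entries $J_n$. Let $a_n^\dagger=\tfrac12\big(\prod_{m<n}Z_m\big)(X-iY)_n$, with adjoint $a_n$, and $$H_{JW}=\sum_{n=1}^{N-1}J_n(a_n^\dagger a_{n+1}+a_{n+1}^\dagger a_n)+2\sum_{n=1}^NB_na_n^\dagger a_n .$$ Let $\wedge$ be the bilinear product on $(\mathbb C^2)^{\otimes N}$ with $|x\rangle\wedge|y\rangle=(-1)^{\#\{(i,j):\,j<i,\ x_i=y_j=1\}}|x+y\rangle$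 if the bit strings $x,y$ have no common $1$, and $|x\rangle\wedge|y\rangle=0$ otherwise; the wedge of no vectors is $|\underline 0\rangle$. Then: 1. $H|a\rangle=H_1|a\rangle-\beta|a\rangle$ for $|a\rangle=\sum_n a_n|\underline n\rangle$. The $a_n$ satisfy $\{a_m,a_n^\dagger\}=\delta_{mn}$, $\{a_m,a_n\}=\{a_m^\dagger,a_n^\dagger\}=0$, $a_m|\underline 0\rangle=0$, and $H=H_{JW}-\beta\,\mathbb 1$. 2. $H_1$ has an orthonormal eigenbasis with real eigenvalues. For every such eigenbasis $|\lambda_n\rangle=\sum_m\lambda_{n,m}|\underline m\rangle$ with $H_1|\lambda_n\rangle=\lambda_n|\lambda_n\rangle$, put $b_n^\dagger=\sum_m\lambda_{n,m}a_m^\dagger$. Then $\{b_m,b_n^\dagger\}=\delta_{mn}$, $\{b_m,b_n\}=\{b_m^\dagger,b_n^\dagger\}=0$, $b_m|\underline 0\rangle=0$, $H_{JW}=\sum_n\lambda_nb_n^\dagger b_n$, and $H_{JW}\big(|\lambda_{n_1}\rangle\wedge\dots\wedge|\lambda_{n_k}\rangle\big)=(\lambda_{n_1}+\dots+\lambda_{n_k})\,|\lambda_{n_1}\rangle\wedge\dots\wedge|\lambda_{n_k}\rangle$.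 3. For single-excitation vectors, $|a\rangle\wedge|b\rangle=-|b\rangle\wedge|a\rangle$ and $|a\rangle\wedge|a\rangle=0$; a basis state with excitations exactly at $n_1<\dots<n_k$ equals $|\underline{n_1}\rangle\wedge\dots\wedge|\underline{n_k}\rangle$; and $|v_1\rangle\wedge\dots\wedge|v_k\rangle=a^\dagger(v_1)\cdots a^\dagger(v_k)|\underline 0\rangle$ with $a^\dagger(v)=\sum_mv_ma_m^\dagger$. 4. For all $t\in\mathbb R$ and $|a\rangle,|b\rangle\in\mathbb C^N$, $$e^{-iHt}(|a\rangle\wedge|b\rangle)=e^{i\beta t}\,\big(e^{-iH_1t}|a\rangle\big)\wedge\big(e^{-iH_1t}|b\rangle\big),$$ and likewise for the wedge of any number of vectors of $\mathbb C^N$. 5. Let $N\ge2$ and suppose perfect transfer $e^{-iH_1t_0}|\underline 1\rangle=e^{i\phi}|\underline N\rangle$ for some real $t_0,\phi$. (a) With $|+\rangle=(|0\rangle+|1\rangle)/\sqrt2$, $e^{-iHt_0}$ maps $|+\rangle|0\rangle^{\otimes(N-2)}|+\rangle$ to the state with all spins other than $1$ and $N$ in $|0\rangle$ and with spins $1,N$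 in $e^{i\beta t_0}\,\tfrac12\big(|00\rangle+e^{i\phi}|01\rangle+e^{i\phi}|10\rangle-e^{2i\phi}|11\rangle\big)$, which is maximally entangled. Suppose moreover that $J_nJ_{N-n}\ge0$ for all $n$ (for example, that all $J_n$ are positive, or that $J_n=J_{N-n}$). Then: (b) $e^{-iHt_0}\big(|\underline{n_1}\rangle\wedge\dots\wedge|\underline{n_k}\rangle\big)=e^{i\beta t_0}e^{ik\phi}\,|\underline{N+1-n_1}\rangle\wedge\dots\wedge|\underline{N+1-n_k}\rangle$ for all sites $n_1,\dots,n_k$. Equivalently, for a bit string $x$ with $k$ ones, $e^{-iHt_0}|x_1\dots x_N\rangle=e^{i\beta t_0}e^{ik\phi}(-1)^{k(k-1)/2}|x_N\dots x_1\rangle$. (c) Let $x$ be a bit string with $x_1=x_2=0$ and $w$ ones, with mirror image $\bar x$, and let $\alpha,\gamma\in\mathbb C$. Then $$e^{-iHt_0}\big((\alpha|\underline1\rangle+\gamma|\underline2\rangle)\wedge|x\rangle\big)=e^{i\beta t_0}e^{i(w+1)\phi}(-1)^{w(w-1)/2}\,(\alpha|\underline N\rangle+\gamma|\underline{N-1}\rangle)\wedge|\bar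 x\rangle ,$$ and $(\alpha|\underline N\rangle+\gamma|\underline{N-1}\rangle)\wedge|\bar x\rangle=(-1)^w|\bar x\rangle\wedge(\alpha|\underline N\rangle+\gamma|\underline{N-1}\rangle)$. (d) (Initialization-free dual-rail transfer.) For every density operator $\rho$ of $N-2$ qubits there is a density operator $\rho'$ of $N-2$ qubits such that for all $\alpha,\gamma\in\mathbb C$, with $|\psi\rangle=\alpha|10\rangle+\gamma|01\rangle$ and $|\bar\psi\rangle=\alpha|01\rangle+\gamma|10\rangle$, $$e^{-iHt_0}\big(|\psi\rangle\langle\psi|_{1,2}\otimes\rho_{3\ldots N}\big)e^{iHt_0}=\rho'_{1\ldots N-2}\otimes|\bar\psi\rangle\langle\bar\psi|_{N-1,N}.$$ -/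

import Mathlib

open scoped Matrix ComplexConjugate ComplexOrder

noncomputable section

namespace SpinChain

/-! Qubit chains. Sites are `0, …, N - 1`; site `n` here is spin `n + 1` in one-based numbering. -/

/-- A computational basis label of `N` qubits, i.e. a bit string. -/
abbrev Config (N : ℕ) := Fin N → Fin 2

/-- A vector of `(ℂ²)^{⊗ N}`, given by its amplitudes in the computational basis. -/
abbrev State (N : ℕ) := Config N → ℂ

/-- A linear operator on `(ℂ²)^{⊗ N}`, as a matrix in the computational basis. -/
abbrev Op (N : ℕ) := Matrix (Config N) (Config N) ℂ

/-- The basis state `|x⟩`. -/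
def ket {N : ℕ} (x : Config N) : State N := Pi.single x 1

/-- The state `|00…0⟩` without excitations. -/
def vacuum (N : ℕ) : State N := ket 0

/-- The product state whose qubit `n` is in the state with amplitudes `f n`. -/
def productState {N : ℕ} (f : Fin N → Fin 2 → ℂ) : State N := fun x => ∏ n, f n (x n)

/-- The Pauli matrices. -/
def pauliX : Matrix (Fin 2) (Fin 2) ℂ := !![0, 1; 1, 0]
def pauliY : Matrix (Fin 2) (Fin 2) ℂ := !![0, -Complex.I; Complex.I, 0]
def pauliZ : Matrix (Fin 2) (Fin 2) ℂ := !![1, 0; 0, -1]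

/-- The tensor product `⨂ₙ f n` of one-qubit operators. -/
def tensorOp {N : ℕ} (f : Fin N → Matrix (Fin 2) (Fin 2) ℂ) : Op N :=
  fun x y => ∏ n, f n (x n) (y n)

/-- The one-qubit operator `M` acting on qubit `n`, identity elsewhere. -/
def siteOp {N : ℕ} (n : Fin N) (M : Matrix (Fin 2) (Fin 2) ℂ) : Op N :=
  tensorOp (Function.update (fun _ => 1) n M)

/-- The two ends of the bond `n`, which carries the coupling `J n`. -/
def leftSite {N : ℕ} (n : Fin (N - 1)) : Fin N := ⟨n, by omega⟩
def rightSite {N : ℕ} (n : Fin (N - 1)) : Fin N := ⟨n + 1, by omega⟩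

/-- The XX Hamiltonian `½ ∑ Jₙ (Xₙ Xₙ₊₁ + Yₙ Yₙ₊₁) - ∑ Bₙ Zₙ` with open boundary conditions. -/
def hamiltonian {N : ℕ} (J : Fin (N - 1) → ℝ) (B : Fin N → ℝ) : Op N :=
  (1 / 2 : ℂ) • ∑ n, (J n : ℂ) •
      (siteOp (leftSite n) pauliX * siteOp (rightSite n) pauliX
        + siteOp (leftSite n) pauliY * siteOp (rightSite n) pauliY)
    - ∑ n, (B n : ℂ) • siteOp n pauliZ

/-- The `N × N` tridiagonal matrix with diagonal `2 Bₙ` and off-diagonal entries `Jₙ`: the block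
of the Hamiltonian with one excitation, after the constant `-∑ Bₙ` has been dropped. -/
def hamiltonianOne {N : ℕ} (J : Fin (N - 1) → ℝ) (B : Fin N → ℝ) : Matrix (Fin N) (Fin N) ℂ :=
  Matrix.diagonal (fun n => (2 * B n : ℂ))
    + ∑ n, (J n : ℂ) • (Matrix.single (leftSite n) (rightSite n) 1
        + Matrix.single (rightSite n) (leftSite n) 1)

/-- Time evolution `e^{-iAt}`. -/
def evolution {ι : Type*} [Fintype ι] [DecidableEq ι] (A : Matrix ι ι ℂ) (t : ℝ) : Matrix ι ι ℂ :=
  NormedSpace.exp ((-(Complex.I * t)) • A)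

/-! The Jordan–Wigner operators. -/

/-- `aₙ† = ½ (∏_{m < n} Zₘ) (X - iY)ₙ`. -/
def create {N : ℕ} (n : Fin N) : Op N :=
  (1 / 2 : ℂ) •
    ((((List.finRange N).filter (fun m => m < n)).map (fun m => siteOp m pauliZ)).prod
      * siteOp n (pauliX - Complex.I • pauliY))

/-- `aₙ`, the adjoint of `aₙ†`. -/
def annihilate {N : ℕ} (n : Fin N) : Op N := (create n)ᴴ

/-- `∑ₘ vₘ aₘ†`, which creates a fermion in the single-excitation state `v`. -/
def createMode {N : ℕ} (v : Fin N → ℂ) : Op N := ∑ m, v m • create m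

/-- `∑ₘ vₘ* aₘ`, the adjoint of `createMode v`. -/
def annihilateMode {N : ℕ} (v : Fin N → ℂ) : Op N := (createMode v)ᴴ

/-- The hopping Hamiltonian `∑ Jₙ (aₙ† aₙ₊₁ + aₙ₊₁† aₙ) + 2 ∑ Bₙ aₙ† aₙ`. -/
def hamiltonianJW {N : ℕ} (J : Fin (N - 1) → ℝ) (B : Fin N → ℝ) : Op N :=
  ∑ n, (J n : ℂ) • (create (leftSite n) * annihilate (rightSite n)
        + create (rightSite n) * annihilate (leftSite n))
    + (2 : ℂ) • ∑ n, (B n : ℂ) • (create n * annihilate n)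

/-- `v n` are orthonormal eigenvectors of the single-excitation matrix, with eigenvalues `lam n`. -/
def IsEigenbasis {N : ℕ} (J : Fin (N - 1) → ℝ) (B : Fin N → ℝ) (lam : Fin N → ℝ)
    (v : OrthonormalBasis (Fin N) ℂ (EuclideanSpace ℂ (Fin N))) : Prop :=
  ∀ n, hamiltonianOne J B *ᵥ (v n).ofLp = (lam n : ℂ) • (v n).ofLp

/-! Excitations and the wedge product. -/

/-- The excited sites of `x`, in increasing order. -/
def excitedSites {N : ℕ} (x : Config N) : List (Fin N) :=
  (List.finRange N).filter (fun n => x n = 1)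

/-- The number of excitations in `x`. -/
def weight {N : ℕ} (x : Config N) : ℕ := (excitedSites x).length

/-- The single excitation at site `n`, as a vector of the single-excitation space `ℂᴺ`. -/
def site {N : ℕ} (n : Fin N) : Fin N → ℂ := Pi.single n 1

/-- The embedding `a ↦ ∑ₙ aₙ |0…010…0⟩` of the single-excitation space into the qubit space. -/
def oneExcitation {N : ℕ} (a : Fin N → ℂ) : State N := ∑ n, a n • ket (Pi.single n 1)

/-- The number of exchanges that bring the excitations of `x` followed by those of `y` into
increasing order. -/
def exchanges {N : ℕ} (x y : Config N) : ℕ :=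
  (Finset.univ.filter (fun p : Fin N × Fin N => p.2 < p.1 ∧ x p.1 = 1 ∧ y p.2 = 1)).card

/-- The wedge product, i.e. the product of the exterior algebra on `ℂᴺ`, where `|x⟩` stands for the
wedge of its excitations in increasing order. Bilinear, with `|x⟩ ∧ |y⟩ = ± |x + y⟩` if `x` and `y`
have no excited site in common and `0` otherwise; the sign is that of the reordering. -/
def wedge {N : ℕ} (ψ χ : State N) : State N := fun z =>
  ∑ x : Config N, ∑ y : Config N,
    if ∀ n, (x n : ℕ) + (y n : ℕ) = (z n : ℕ) then (-1) ^ exchanges x y * (ψ x * χ y) else 0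

/-- `v₁ ∧ v₂ ∧ … ∧ vₖ` for a list of single-excitation vectors. -/
def wedgeList {N : ℕ} (l : List (Fin N → ℂ)) : State N :=
  (l.map oneExcitation).foldr wedge (vacuum N)

/-! State transfer. -/

/-- The first two and the last two sites of a chain. -/
def firstSite {N : ℕ} (hN : 2 ≤ N) : Fin N := ⟨0, by omega⟩
def secondSite {N : ℕ} (hN : 2 ≤ N) : Fin N := ⟨1, by omega⟩
def nextToLastSite {N : ℕ} (hN : 2 ≤ N) : Fin N := ⟨N - 2, by omega⟩
def lastSite {N : ℕ} (hN : 2 ≤ N) : Fin N := ⟨N - 1, by omega⟩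

/-- Perfect transfer of an excitation from the first to the last spin in time `t₀`, with phase
`e^{iφ}`. -/
def IsPerfectTransfer {N : ℕ} (hN : 2 ≤ N) (J : Fin (N - 1) → ℝ) (B : Fin N → ℝ) (t₀ φ : ℝ) :
    Prop :=
  evolution (hamiltonianOne J B) t₀ *ᵥ site (firstSite hN)
    = Complex.exp (Complex.I * φ) • site (lastSite hN)

/-- The one-qubit states `|0⟩` and `|+⟩ = (|0⟩ + |1⟩) / √2`. -/
def qubitZero : Fin 2 → ℂ := ![1, 0]
def qubitPlus : Fin 2 → ℂ := ![1 / (Real.sqrt 2 : ℂ), 1 / (Real.sqrt 2 : ℂ)]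

/-- The two-qubit state `∑ C a b |a⟩|b⟩` on the first and last spin, all other spins in `|0⟩`. -/
def endsState {N : ℕ} (hN : 2 ≤ N) (C : Matrix (Fin 2) (Fin 2) ℂ) : State N := fun x =>
  if ∀ n, n ≠ firstSite hN → n ≠ lastSite hN → x n = 0 then C (x (firstSite hN)) (x (lastSite hN)) else 0

/-- The pure two-qubit state `∑ C a b |a⟩|b⟩` is maximally entangled: the reduced states
`C Cᴴ` and `Cᵀ (Cᵀ)ᴴ` of both qubits are maximally mixed. -/
def IsMaximallyEntangled (C : Matrix (Fin 2) (Fin 2) ℂ) : Prop :=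
  C * Cᴴ = (1 / 2 : ℂ) • (1 : Matrix (Fin 2) (Fin 2) ℂ) ∧
    Cᵀ * (Cᵀ)ᴴ = (1 / 2 : ℂ) • (1 : Matrix (Fin 2) (Fin 2) ℂ)

/-- The dual-rail encoding `α |10⟩ + β |01⟩` of a qubit into two. -/
def dualRail (α β : ℂ) : Matrix (Fin 2) (Fin 2) ℂ := !![0, β; α, 0]

/-- The bits of `x` on all spins but the first two, respectively but the last two. -/
def tailBits {N : ℕ} (x : Config N) : Config (N - 2) := fun n => x ⟨n + 2, by omega⟩
def initBits {N : ℕ} (x : Config N) : Config (N - 2) := fun n => x ⟨n, by omega⟩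

/-- `|C⟩⟨C| ⊗ ρ`, with `|C⟩ = ∑ C a b |a⟩|b⟩` on the first and second spin and `ρ` on the others. -/
def encodedAtStart {N : ℕ} (hN : 2 ≤ N) (C : Matrix (Fin 2) (Fin 2) ℂ) (ρ : Op (N - 2)) : Op N :=
  fun x y => C (x (firstSite hN)) (x (secondSite hN)) * conj (C (y (firstSite hN)) (y (secondSite hN)))
    * ρ (tailBits x) (tailBits y)

/-- `ρ ⊗ |C⟩⟨C|`, with `|C⟩ = ∑ C a b |a⟩|b⟩` on the last spin (label `a`) and the next-to-last
spin (label `b`), and `ρ` on the others. -/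
def encodedAtEnd {N : ℕ} (hN : 2 ≤ N) (C : Matrix (Fin 2) (Fin 2) ℂ) (ρ : Op (N - 2)) : Op N :=
  fun x y => C (x (lastSite hN)) (x (nextToLastSite hN)) * conj (C (y (lastSite hN)) (y (nextToLastSite hN)))
    * ρ (initBits x) (initBits y)

/-- A density operator. -/
def IsDensity {N : ℕ} (ρ : Op N) : Prop := ρ.PosSemidef ∧ ρ.trace = 1

end SpinChain

end

open SpinChain

open scoped Matrix ComplexConjugate ComplexOrder

noncomputable section

namespace SpinChain

/-! Products of one-qubit operators. -/

/-! Written in the operators `create` and `annihilate`, the chain is a gas of free fermions. The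
canonical anticommutation relations are checked site by site: two tensor products anticommute when
their factors anticommute at one site and commute at all others, and the `pauliZ` strings provide
exactly this. On a bond the strings cancel, so `hamiltonian` is, up to the constant `-∑ B n`, the
second quantization of `hamiltonianOne`.

The `pauliZ` string in `create_apply` is also the reordering sign of the wedge product. Hence
wedging on the left with a single excitation is applying `createMode` (`wedge_oneExcitation`), and
every statement about wedges becomes one about products of creation operators on the vacuum. The
commutator of `secondQuantization M` with `createMode v` is `createMode (M *ᵥ v)`
(`secondQuantization_mul_createMode`). On eigenvectors of the one-particle matrix this exponentiates
to an intertwining relation, and linearity extends it to all vectors (`evolution_mul_createMode`).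
As the vacuum only picks up a phase, each factor of a wedge evolves independently.

For perfect transfer, the one-particle propagator is unitary, symmetric and commutes with a
tridiagonal matrix whose couplings do not vanish. These properties determine its columns one after
another from the first: up to a common phase the propagator is the mirror reflection
(`IsPerfectTransfer.mirror`). Reflection reverses the order of the excitations, whence the sign
`(-1) ^ choose k 2`. In the dual-rail code the encoded pair always carries exactly one excitation,
so the phases and signs depend only on the rest of the chain and are absorbed into its state. -/

theorem tensorOp_mul {N : ℕ} (f g : Fin N → Matrix (Fin 2) (Fin 2) ℂ) :
    tensorOp f * tensorOp g = tensorOp (fun n => f n * g n) := by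
  ext x y
  simp only [tensorOp, Matrix.mul_apply, Finset.prod_univ_sum, Fintype.piFinset_univ,
    Finset.prod_mul_distrib]

theorem tensorOp_one {N : ℕ} : tensorOp (fun _ : Fin N => 1) = 1 := by
  ext x y
  simp only [tensorOp, Matrix.one_apply, Finset.prod_ite_zero, Finset.mem_univ, true_imp_iff,
    Finset.prod_const_one, funext_iff]

theorem tensorOp_conjTranspose {N : ℕ} (f : Fin N → Matrix (Fin 2) (Fin 2) ℂ) :
    (tensorOp f)ᴴ = tensorOp (fun n => (f n)ᴴ) := by
  ext x y
  simp [tensorOp, Matrix.conjTranspose_apply]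

theorem tensorOp_add_eq {N : ℕ} {f g k : Fin N → Matrix (Fin 2) (Fin 2) ℂ} (n : Fin N)
    (h : f n + g n = k n) (hf : ∀ m, m ≠ n → f m = k m) (hg : ∀ m, m ≠ n → g m = k m) :
    tensorOp f + tensorOp g = tensorOp k := by
  ext x y
  simp only [tensorOp, Matrix.add_apply]
  rw [← Finset.mul_prod_erase _ _ (Finset.mem_univ n), ← Finset.mul_prod_erase _ _ (Finset.mem_univ n),
    ← Finset.mul_prod_erase _ _ (Finset.mem_univ n), ← h, Matrix.add_apply, add_mul]
  congr 2 <;> refine Finset.prod_congr rfl fun m hm => ?_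
  · rw [hf m (Finset.ne_of_mem_erase hm)]
  · rw [hg m (Finset.ne_of_mem_erase hm)]

theorem tensorOp_eq_zero {N : ℕ} {f : Fin N → Matrix (Fin 2) (Fin 2) ℂ} (n : Fin N)
    (h : f n = 0) : tensorOp f = 0 := by
  ext x y
  exact Finset.prod_eq_zero (Finset.mem_univ n) (by simp [h])

/-- The two products agree up to sign at site `n` and exactly elsewhere, so their sum is a tensor
product with a zero factor. -/
theorem tensorOp_anticomm {N : ℕ} {f g : Fin N → Matrix (Fin 2) (Fin 2) ℂ} (n : Fin N)
    (h : f n * g n + g n * f n = 0) (hc : ∀ m, m ≠ n → f m * g m = g m * f m) :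
    tensorOp f * tensorOp g + tensorOp g * tensorOp f = 0 := by
  rw [tensorOp_mul, tensorOp_mul, tensorOp_add_eq (k := Function.update (fun m => f m * g m) n 0) n]
  · exact tensorOp_eq_zero n (by simp)
  · simpa using h
  · intro m hm; simp [hm]
  · intro m hm; simp [hm, hc m hm]

theorem siteOp_add {N : ℕ} (n : Fin N) (A B : Matrix (Fin 2) (Fin 2) ℂ) :
    siteOp n (A + B) = siteOp n A + siteOp n B :=
  (tensorOp_add_eq n (by simp) (fun m hm => by simp [hm]) (fun m hm => by simp [hm])).symm

theorem siteOp_smul {N : ℕ} (n : Fin N) (c : ℂ) (A : Matrix (Fin 2) (Fin 2) ℂ) :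
    siteOp n (c • A) = c • siteOp n A := by
  ext x y
  simp only [siteOp, tensorOp, Matrix.smul_apply, smul_eq_mul]
  rw [← Finset.mul_prod_erase _ _ (Finset.mem_univ n),
    ← Finset.mul_prod_erase (a := n) _ _ (Finset.mem_univ n), ← mul_assoc]
  congr 1
  · simp
  · refine Finset.prod_congr rfl fun m hm => ?_
    simp [Function.update_of_ne (Finset.ne_of_mem_erase hm)]

theorem siteOp_one {N : ℕ} (n : Fin N) : siteOp n 1 = 1 := by
  rw [siteOp, Function.update_eq_self_iff.2 rfl, tensorOp_one]

/-! The Jordan–Wigner operators as products of one-qubit operators. -/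

/-- The one-qubit operator `|1⟩⟨0|`. -/
def raising : Matrix (Fin 2) (Fin 2) ℂ := !![0, 0; 1, 0]

/-- The one-qubit factors of `aₙ†`. -/
def creationFactor {N : ℕ} (n m : Fin N) : Matrix (Fin 2) (Fin 2) ℂ :=
  if m < n then pauliZ else if m = n then raising else 1

theorem pauliZ_conjTranspose : pauliZᴴ = pauliZ := by
  ext i j; fin_cases i <;> fin_cases j <;> simp [pauliZ]

theorem pauliZ_mul_pauliZ : pauliZ * pauliZ = 1 := by
  ext i j; fin_cases i <;> fin_cases j <;> simp [pauliZ, Matrix.mul_apply, Fin.sum_univ_two]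

theorem raising_conjTranspose : raisingᴴ = !![0, 1; 0, 0] := by
  ext i j; fin_cases i <;> fin_cases j <;> simp [raising]

theorem raising_mul_raising : raising * raising = 0 := by
  ext i j; fin_cases i <;> fin_cases j <;> simp [raising, Matrix.mul_apply, Fin.sum_univ_two]

theorem raising_anticomm_pauliZ : raising * pauliZ + pauliZ * raising = 0 := by
  ext i j
  fin_cases i <;> fin_cases j <;> simp [raising, pauliZ]

theorem raising_conjTranspose_anticomm_pauliZ : raisingᴴ * pauliZ + pauliZ * raisingᴴ = 0 := by
  rw [raising_conjTranspose]
  ext i j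
  fin_cases i <;> fin_cases j <;> simp [pauliZ]

theorem raising_anticomm_conjTranspose : raisingᴴ * raising + raising * raisingᴴ = 1 := by
  rw [raising_conjTranspose]
  ext i j
  fin_cases i <;> fin_cases j <;> simp [raising]

theorem pauliX_eq : pauliX = raising + raisingᴴ := by
  rw [raising_conjTranspose]
  ext i j; fin_cases i <;> fin_cases j <;> simp [pauliX, raising]

theorem pauliY_eq : pauliY = Complex.I • raising + (-Complex.I) • raisingᴴ := by
  rw [raising_conjTranspose]
  ext i j; fin_cases i <;> fin_cases j <;> simp [pauliY, raising]

theorem pauliZ_eq : pauliZ = 1 + (-2 : ℂ) • (raising * raisingᴴ) := by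
  rw [raising_conjTranspose]
  ext i j
  fin_cases i <;> fin_cases j <;> norm_num [pauliZ, raising, Matrix.mul_apply, Fin.sum_univ_two]

theorem pauliX_sub_smul_pauliY : pauliX - Complex.I • pauliY = (2 : ℂ) • raising := by
  ext i j; fin_cases i <;> fin_cases j <;> norm_num [pauliX, pauliY, raising]

theorem siteOp_pauliZ_prod {N : ℕ} (l : List (Fin N)) (hl : l.Nodup) :
    (l.map fun m => siteOp m pauliZ).prod = tensorOp (fun m => if m ∈ l then pauliZ else 1) := by
  induction l with
  | nil => simp [tensorOp_one]
  | cons n l ih =>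
    rw [List.nodup_cons] at hl
    rw [List.map_cons, List.prod_cons, ih hl.2, siteOp, tensorOp_mul]
    congr 1
    funext m
    by_cases h : m = n
    · subst h; simp [hl.1]
    · simp [h]

theorem create_eq_tensorOp {N : ℕ} (n : Fin N) : create n = tensorOp (creationFactor n) := by
  rw [create, pauliX_sub_smul_pauliY, siteOp_smul, Matrix.mul_smul, smul_smul,
    siteOp_pauliZ_prod _ ((List.nodup_finRange N).filter _), siteOp, tensorOp_mul]
  norm_num
  congr 1
  funext m
  rcases lt_trichotomy m n with h | h | h
  · simp [creationFactor, h, h.ne]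
  · subst h; simp [creationFactor]
  · simp [creationFactor, h.ne', h.not_gt]

theorem annihilate_eq_tensorOp {N : ℕ} (n : Fin N) :
    annihilate n = tensorOp (fun m => (creationFactor n m)ᴴ) := by
  rw [annihilate, create_eq_tensorOp, tensorOp_conjTranspose]

/-- For `m < n` the only sign comes from site `m`, where `raising` meets the string of `create n`;
for `m = n` it suffices that `raising` squares to zero. -/
theorem create_anticomm {N : ℕ} (m n : Fin N) :
    create m * create n + create n * create m = 0 := by
  wlog hmn : m ≤ n generalizing m n
  · rw [add_comm]; exact this n m (le_of_not_ge hmn)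
  rw [create_eq_tensorOp, create_eq_tensorOp]
  rcases hmn.lt_or_eq with h | rfl
  · refine tensorOp_anticomm m ?_ fun i hi => ?_
    · simpa [creationFactor, h] using raising_anticomm_pauliZ
    · simp only [creationFactor]
      (split_ifs <;> simp_all); omega
  · refine tensorOp_anticomm m ?_ fun i _ => rfl
    simp [creationFactor, raising_mul_raising]

theorem annihilate_anticomm {N : ℕ} (m n : Fin N) :
    annihilate m * annihilate n + annihilate n * annihilate m = 0 := by
  rw [annihilate, annihilate, ← Matrix.conjTranspose_mul, ← Matrix.conjTranspose_mul,
    ← Matrix.conjTranspose_add, create_anticomm, Matrix.conjTranspose_zero]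

theorem annihilate_anticomm_create {N : ℕ} (m n : Fin N) :
    annihilate m * create n + create n * annihilate m = (if m = n then 1 else 0) := by
  rw [create_eq_tensorOp, annihilate_eq_tensorOp]
  rcases lt_trichotomy m n with h | rfl | h
  · rw [if_neg h.ne]
    refine tensorOp_anticomm m ?_ fun i hi => ?_
    · simpa [creationFactor, h] using raising_conjTranspose_anticomm_pauliZ
    · simp only [creationFactor]
      (split_ifs <;> simp_all [pauliZ_conjTranspose]); omega
  · rw [if_pos rfl, tensorOp_mul, tensorOp_mul, ← tensorOp_one]
    refine tensorOp_add_eq m ?_ (fun i hi => ?_) (fun i hi => ?_)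
    · simpa [creationFactor] using raising_anticomm_conjTranspose
    all_goals
      simp only [creationFactor]
      split_ifs <;> simp_all [pauliZ_conjTranspose, pauliZ_mul_pauliZ]
  · rw [if_neg h.ne']
    refine tensorOp_anticomm n ?_ fun i hi => ?_
    · simpa [creationFactor, h, pauliZ_conjTranspose, add_comm] using raising_anticomm_pauliZ
    · simp only [creationFactor]
      (split_ifs <;> simp_all [pauliZ_conjTranspose]); omega

theorem create_mul_annihilate_self {N : ℕ} (n : Fin N) :
    create n * annihilate n = siteOp n (raising * raisingᴴ) := by
  rw [create_eq_tensorOp, annihilate_eq_tensorOp, tensorOp_mul, siteOp]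
  congr 1
  funext m
  rcases lt_trichotomy m n with h | h | h
  · simp [creationFactor, h, h.ne, pauliZ_conjTranspose, pauliZ_mul_pauliZ]
  · subst h; simp [creationFactor]
  · simp [creationFactor, h.ne', h.not_gt]

theorem raising_mul_pauliZ : raising * pauliZ = raising := by
  ext i j; fin_cases i <;> fin_cases j <;> simp [raising, pauliZ, Matrix.mul_apply, Fin.sum_univ_two]

theorem leftSite_lt_rightSite {N : ℕ} (n : Fin (N - 1)) : leftSite n < rightSite n := by
  simp [leftSite, rightSite, Fin.lt_def]

theorem siteOp_commute {N : ℕ} {m n : Fin N} (h : m ≠ n) (A C : Matrix (Fin 2) (Fin 2) ℂ) :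
    siteOp m A * siteOp n C = siteOp n C * siteOp m A := by
  rw [siteOp, siteOp, tensorOp_mul, tensorOp_mul]
  congr 1
  funext i
  by_cases h1 : i = m
  · subst h1; simp [h]
  · simp [h1]

/-- Neighbouring strings cancel left of the bond, and the one surviving `pauliZ`, at the left site,
is absorbed by `raising`. This locality makes the spin Hamiltonian quadratic in the fermions. -/
theorem create_mul_annihilate_bond {N : ℕ} (n : Fin (N - 1)) :
    create (leftSite n) * annihilate (rightSite n)
      = siteOp (leftSite n) raising * siteOp (rightSite n) raisingᴴ := by
  have hlr := leftSite_lt_rightSite n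
  rw [create_eq_tensorOp, annihilate_eq_tensorOp, tensorOp_mul, siteOp, siteOp, tensorOp_mul]
  congr 1
  funext m
  rcases lt_trichotomy m (leftSite n) with h | h | h
  · simp [creationFactor, h, h.ne, h.trans hlr, (h.trans hlr).ne, pauliZ_conjTranspose,
      pauliZ_mul_pauliZ]
  · subst h; simp [creationFactor, hlr, hlr.ne, pauliZ_conjTranspose, raising_mul_pauliZ]
  · have h' : rightSite n ≤ m := by
      simp only [leftSite, rightSite, Fin.lt_def, Fin.le_def] at *; omega
    rcases h'.lt_or_eq with h'' | h''
    · simp [creationFactor, h.ne', h.not_gt, h''.ne', h''.not_gt]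
    · subst h''; simp [creationFactor, h.ne', h.not_gt]

theorem create_mul_annihilate_bond' {N : ℕ} (n : Fin (N - 1)) :
    create (rightSite n) * annihilate (leftSite n)
      = siteOp (leftSite n) raisingᴴ * siteOp (rightSite n) raising := by
  -- The reverse hopping term is the adjoint of the forward one.
  have h := congrArg Matrix.conjTranspose (create_mul_annihilate_bond n)
  have hs : ∀ (m : Fin N) (A : Matrix (Fin 2) (Fin 2) ℂ), (siteOp m A)ᴴ = siteOp m Aᴴ := by
    intro m A
    rw [siteOp, tensorOp_conjTranspose, siteOp]
    congr 1
    funext i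
    by_cases hi : i = m
    · subst hi; simp
    · simp [hi]
  rw [Matrix.conjTranspose_mul, Matrix.conjTranspose_mul, annihilate,
    Matrix.conjTranspose_conjTranspose, hs, hs, Matrix.conjTranspose_conjTranspose] at h
  rw [annihilate, h, siteOp_commute (leftSite_lt_rightSite n).ne']

/-- The terms raising both spins or lowering both cancel between `pauliX` and `pauliY`; the exchange
terms double. -/
theorem hopping_bond {N : ℕ} (n : Fin (N - 1)) :
    siteOp (leftSite n) pauliX * siteOp (rightSite n) pauliX
        + siteOp (leftSite n) pauliY * siteOp (rightSite n) pauliY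
      = (2 : ℂ) • (create (leftSite n) * annihilate (rightSite n)
          + create (rightSite n) * annihilate (leftSite n)) := by
  rw [create_mul_annihilate_bond, create_mul_annihilate_bond']
  simp only [pauliX_eq, pauliY_eq, siteOp_add, siteOp_smul, add_mul, mul_add, Matrix.smul_mul,
    Matrix.mul_smul, smul_smul]
  simp only [mul_neg, neg_mul, Complex.I_mul_I]
  module

/-- The Jordan–Wigner form of the XX Hamiltonian. -/
theorem hamiltonian_eq {N : ℕ} (J : Fin (N - 1) → ℝ) (B : Fin N → ℝ) :
    hamiltonian J B = hamiltonianJW J B - (∑ n, (B n : ℂ)) • (1 : Op N) := by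
  rw [hamiltonian, hamiltonianJW]
  have h1 : ∀ n : Fin N, (B n : ℂ) • siteOp n pauliZ
      = (B n : ℂ) • (1 : Op N) - (2 : ℂ) • ((B n : ℂ) • (create n * annihilate n)) := by
    intro n
    rw [create_mul_annihilate_self, pauliZ_eq, siteOp_add, siteOp_one, siteOp_smul]
    module
  have h2 : (1 / 2 : ℂ) • ∑ n, (J n : ℂ) • (siteOp (leftSite n) pauliX * siteOp (rightSite n) pauliX
        + siteOp (leftSite n) pauliY * siteOp (rightSite n) pauliY)
      = ∑ n, (J n : ℂ) • (create (leftSite n) * annihilate (rightSite n)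
          + create (rightSite n) * annihilate (leftSite n)) := by
    rw [Finset.smul_sum]
    refine Finset.sum_congr rfl fun n _ => ?_
    rw [hopping_bond]
    module
  rw [h2, Finset.sum_congr rfl fun n _ => h1 n, Finset.sum_sub_distrib, Finset.sum_smul,
    Finset.smul_sum]
  abel

/-! Modes. -/

theorem createMode_smul {N : ℕ} (c : ℂ) (v : Fin N → ℂ) :
    createMode (c • v) = c • createMode v := by
  simp [createMode, Finset.smul_sum, smul_smul]

theorem createMode_site {N : ℕ} (n : Fin N) : createMode (site n) = create n := by
  rw [createMode, Finset.sum_eq_single n]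
  · simp [site]
  · intro m _ hm; simp [site, hm]
  · simp

theorem createMode_sum {N : ℕ} {ι : Type*} (s : Finset ι) (v : ι → Fin N → ℂ) :
    createMode (∑ i ∈ s, v i) = ∑ i ∈ s, createMode (v i) := by
  simp only [createMode, Finset.sum_apply, Finset.sum_smul]
  exact Finset.sum_comm

theorem annihilateMode_eq {N : ℕ} (v : Fin N → ℂ) :
    annihilateMode v = ∑ m, conj (v m) • annihilate m := by
  simp [annihilateMode, createMode, Matrix.conjTranspose_sum, annihilate]

theorem createMode_anticomm {N : ℕ} (v w : Fin N → ℂ) :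
    createMode v * createMode w + createMode w * createMode v = 0 := by
  simp only [createMode, Finset.sum_mul_sum, Matrix.smul_mul, Matrix.mul_smul]
  rw [Finset.sum_comm (f := fun i j => v j • w i • (create i * create j)), ← Finset.sum_add_distrib]
  refine Finset.sum_eq_zero fun i _ => ?_
  rw [← Finset.sum_add_distrib]
  refine Finset.sum_eq_zero fun j _ => ?_
  rw [smul_comm (w j), ← smul_add, ← smul_add, create_anticomm, smul_zero, smul_zero]

theorem createMode_mul_comm {N : ℕ} (v w : Fin N → ℂ) :
    createMode v * createMode w = -(createMode w * createMode v) :=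
  eq_neg_of_add_eq_zero_left (createMode_anticomm v w)

theorem annihilateMode_anticomm {N : ℕ} (v w : Fin N → ℂ) :
    annihilateMode v * annihilateMode w + annihilateMode w * annihilateMode v = 0 := by
  rw [annihilateMode, annihilateMode, ← Matrix.conjTranspose_mul, ← Matrix.conjTranspose_mul,
    ← Matrix.conjTranspose_add, createMode_anticomm, Matrix.conjTranspose_zero]

theorem annihilateMode_anticomm_createMode {N : ℕ} (v w : Fin N → ℂ) :
    annihilateMode v * createMode w + createMode w * annihilateMode v
      = (∑ m, conj (v m) * w m) • (1 : Op N) := by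
  rw [annihilateMode_eq]
  simp only [createMode, Finset.sum_mul_sum, Matrix.smul_mul, Matrix.mul_smul]
  rw [Finset.sum_comm (f := fun i j => conj (v j) • w i • (create i * annihilate j)),
    ← Finset.sum_add_distrib, Finset.sum_smul]
  refine Finset.sum_congr rfl fun i _ => ?_
  rw [← Finset.sum_add_distrib, Finset.sum_eq_single i]
  · rw [smul_comm (w i), ← smul_add, ← smul_add, annihilate_anticomm_create, if_pos rfl, smul_smul]
  · intro j _ hj
    rw [smul_comm (w j), ← smul_add, ← smul_add, annihilate_anticomm_create, if_neg hj.symm,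
      smul_zero, smul_zero]
  · simp

/-! Action on basis states. -/

theorem single_one_add_eq_iff {N : ℕ} (n : Fin N) (y z : Config N) (m : Fin N) :
    ((Pi.single n 1 : Config N) m : ℕ) + (y m : ℕ) = (z m : ℕ)
      ↔ if m = n then y m = 0 ∧ z m = 1 else z m = y m := by
  split_ifs with h
  · subst h
    generalize y m = a
    generalize z m = b
    simp only [Pi.single_eq_same]
    revert a b
    decide
  · simp only [Pi.single_eq_of_ne h]
    rw [Fin.ext_iff, eq_comm]
    simp

theorem exchanges_single_left {N : ℕ} (n : Fin N) (y : Config N) :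
    exchanges (Pi.single n 1) y = (Finset.univ.filter fun m => m < n ∧ y m = 1).card := by
  rw [exchanges]
  refine (Finset.card_bij (fun m _ => (n, m)) ?_ ?_ ?_).symm
  · intro m hm; simpa using hm
  · intro a _ b _ h; exact (Prod.mk.inj h).2
  · rintro ⟨a, b⟩ h
    simp only [Finset.mem_filter, Finset.mem_univ, true_and] at h
    have ha : a = n := by
      by_contra hne
      simp [Pi.single_eq_of_ne hne] at h
    subst ha
    exact ⟨b, by simpa using ⟨h.1, h.2.2⟩, rfl⟩

theorem exchanges_single_right {N : ℕ} (n : Fin N) (y : Config N) :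
    exchanges y (Pi.single n 1) = (Finset.univ.filter fun m => n < m ∧ y m = 1).card := by
  rw [exchanges]
  refine (Finset.card_bij (fun m _ => (m, n)) ?_ ?_ ?_).symm
  · intro m hm; simpa using hm
  · intro a _ b _ h; exact (Prod.mk.inj h).1
  · rintro ⟨a, b⟩ h
    simp only [Finset.mem_filter, Finset.mem_univ, true_and] at h
    have hb : b = n := by
      by_contra hne
      simp [Pi.single_eq_of_ne hne] at h
    subst hb
    exact ⟨a, by simpa using ⟨h.1, h.2.1⟩, rfl⟩

/-- Each site factor is the indicator of bitwise addition, times `-1` at an excited site left of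
`n`. The product of these signs is the sign in the definition of `wedge`. -/
theorem create_apply {N : ℕ} (n : Fin N) (z y : Config N) :
    create n z y = if ∀ m, ((Pi.single n 1 : Config N) m : ℕ) + (y m : ℕ) = (z m : ℕ)
      then (-1) ^ exchanges (Pi.single n 1) y else 0 := by
  have h : ∀ m, creationFactor n m (z m) (y m)
      = if ((Pi.single n 1 : Config N) m : ℕ) + (y m : ℕ) = (z m : ℕ)
        then (if m < n ∧ y m = 1 then -1 else 1) else 0 := by
    intro m
    rw [if_congr (single_one_add_eq_iff n y z m) rfl rfl, creationFactor]
    generalize y m = a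
    generalize z m = b
    rcases lt_trichotomy m n with h | h | h
    · simp only [h, h.ne, if_true, if_false, true_and]
      fin_cases a <;> fin_cases b <;> simp [pauliZ]
    · subst h
      fin_cases a <;> fin_cases b <;> simp [raising]
    · simp only [h.ne', h.not_gt, if_false, false_and]
      fin_cases a <;> fin_cases b <;> simp
  rw [create_eq_tensorOp, tensorOp, Finset.prod_congr rfl fun m _ => h m, Finset.prod_ite_zero,
    exchanges_single_left, Finset.prod_ite]
  simp

/-! ### The wedge product through creation operators. -/

theorem wedge_add_left {N : ℕ} (ψ₁ ψ₂ χ : State N) :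
    wedge (ψ₁ + ψ₂) χ = wedge ψ₁ χ + wedge ψ₂ χ := by
  funext z
  simp only [wedge, Pi.add_apply, ← Finset.sum_add_distrib]
  refine Finset.sum_congr rfl fun x _ => Finset.sum_congr rfl fun y _ => ?_
  split_ifs <;> ring

theorem wedge_smul_left {N : ℕ} (c : ℂ) (ψ χ : State N) :
    wedge (c • ψ) χ = c • wedge ψ χ := by
  funext z
  simp only [wedge, Pi.smul_apply, smul_eq_mul, Finset.mul_sum]
  refine Finset.sum_congr rfl fun x _ => Finset.sum_congr rfl fun y _ => ?_
  split_ifs <;> ring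

theorem wedge_add_right {N : ℕ} (ψ χ₁ χ₂ : State N) :
    wedge ψ (χ₁ + χ₂) = wedge ψ χ₁ + wedge ψ χ₂ := by
  funext z
  simp only [wedge, Pi.add_apply, ← Finset.sum_add_distrib]
  refine Finset.sum_congr rfl fun x _ => Finset.sum_congr rfl fun y _ => ?_
  split_ifs <;> ring

theorem wedge_smul_right {N : ℕ} (c : ℂ) (ψ χ : State N) :
    wedge ψ (c • χ) = c • wedge ψ χ := by
  funext z
  simp only [wedge, Pi.smul_apply, smul_eq_mul, Finset.mul_sum]
  refine Finset.sum_congr rfl fun x _ => Finset.sum_congr rfl fun y _ => ?_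
  split_ifs <;> ring

/-- The wedge product as a bilinear map. -/
def wedgeLin (N : ℕ) : State N →ₗ[ℂ] State N →ₗ[ℂ] State N :=
  LinearMap.mk₂ ℂ wedge wedge_add_left wedge_smul_left wedge_add_right wedge_smul_right

theorem wedge_single {N : ℕ} (n : Fin N) (χ : State N) :
    wedge (ket (Pi.single n 1)) χ = create n *ᵥ χ := by
  funext z
  rw [wedge, Finset.sum_eq_single (Pi.single n 1)]
  · simp only [Matrix.mulVec, dotProduct, create_apply, ket, Pi.single_eq_same, one_mul, ite_mul,
      zero_mul]
  · intro x _ hx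
    simp [ket, Pi.single_eq_of_ne hx]
  · simp

/-- This bridge reduces exchange, exclusion and evolution of wedges to the anticommutation
relations. -/
theorem wedge_oneExcitation {N : ℕ} (v : Fin N → ℂ) (χ : State N) :
    wedge (oneExcitation v) χ = createMode v *ᵥ χ := by
  have h : wedgeLin N (oneExcitation v) χ = createMode v *ᵥ χ := by
    simp only [oneExcitation, createMode, map_sum, map_smul, LinearMap.sum_apply,
      LinearMap.smul_apply, Matrix.sum_mulVec, Matrix.smul_mulVec]
    exact Finset.sum_congr rfl fun n _ => congrArg (v n • ·) (wedge_single n χ)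
  exact h

theorem wedgeList_nil {N : ℕ} : wedgeList ([] : List (Fin N → ℂ)) = vacuum N := rfl

theorem wedgeList_cons {N : ℕ} (v : Fin N → ℂ) (l : List (Fin N → ℂ)) :
    wedgeList (v :: l) = createMode v *ᵥ wedgeList l :=
  wedge_oneExcitation v _

theorem wedgeList_eq {N : ℕ} (l : List (Fin N → ℂ)) :
    wedgeList l = (l.map createMode).prod *ᵥ vacuum N := by
  induction l with
  | nil => simp [wedgeList_nil]
  | cons v l ih => rw [wedgeList_cons, ih, List.map_cons, List.prod_cons, Matrix.mulVec_mulVec]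

theorem single_add_eq_iff_update {N : ℕ} (n : Fin N) (y z : Config N) (h : y n = 0) :
    (∀ m, ((Pi.single n 1 : Config N) m : ℕ) + (y m : ℕ) = (z m : ℕ))
      ↔ z = Function.update y n 1 := by
  simp only [single_one_add_eq_iff]
  rw [funext_iff]
  refine forall_congr' fun m => ?_
  by_cases hm : m = n
  · subst hm; simp [h]
  · simp [hm]

theorem create_mulVec_ket {N : ℕ} (n : Fin N) (y : Config N) (h : y n = 0) :
    create n *ᵥ ket y
      = (-1 : ℂ) ^ exchanges (Pi.single n 1) y • ket (Function.update y n 1) := by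
  funext z
  simp only [ket, Matrix.mulVec_single_one, Matrix.col_apply, create_apply,
    single_add_eq_iff_update n y z h, Pi.smul_apply, smul_eq_mul]
  simp only [Pi.single_apply, mul_ite, mul_one, mul_zero]

theorem createMode_mulVec_vacuum {N : ℕ} (v : Fin N → ℂ) :
    createMode v *ᵥ vacuum N = oneExcitation v := by
  simp only [createMode, oneExcitation, Matrix.sum_mulVec, Matrix.smul_mulVec, vacuum]
  refine Finset.sum_congr rfl fun n _ => ?_
  rw [create_mulVec_ket n 0 rfl, exchanges_single_left]
  simp [Pi.single]

theorem annihilate_mulVec_vacuum {N : ℕ} (n : Fin N) : annihilate n *ᵥ vacuum N = 0 := by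
  funext z
  simp only [vacuum, ket, Matrix.mulVec_single_one, Matrix.col_apply, annihilate,
    Matrix.conjTranspose_apply, create_apply, Pi.zero_apply]
  rw [if_neg, star_zero]
  intro h
  have := h n
  simp at this

theorem annihilateMode_mulVec_vacuum {N : ℕ} (v : Fin N → ℂ) :
    annihilateMode v *ᵥ vacuum N = 0 := by
  simp [annihilateMode_eq, Matrix.sum_mulVec, Matrix.smul_mulVec, annihilate_mulVec_vacuum]

theorem wedge_oneExcitation_comm {N : ℕ} (a b : Fin N → ℂ) :
    wedge (oneExcitation a) (oneExcitation b) = -wedge (oneExcitation b) (oneExcitation a) := by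
  rw [wedge_oneExcitation, wedge_oneExcitation, ← createMode_mulVec_vacuum,
    ← createMode_mulVec_vacuum, Matrix.mulVec_mulVec, Matrix.mulVec_mulVec, createMode_mul_comm,
    Matrix.neg_mulVec]

theorem wedge_oneExcitation_self {N : ℕ} (a : Fin N → ℂ) :
    wedge (oneExcitation a) (oneExcitation a) = 0 :=
  self_eq_neg.1 (wedge_oneExcitation_comm a a)

theorem wedgeList_site_of_pairwise {N : ℕ} (l : List (Fin N)) (hl : l.Pairwise (· < ·)) :
    wedgeList (l.map site) = ket (fun n => if n ∈ l then 1 else 0) := by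
  induction l with
  | nil => simp [wedgeList_nil, vacuum]; rfl
  | cons n l ih =>
    rw [List.pairwise_cons] at hl
    have hn : n ∉ l := fun h => lt_irrefl n (hl.1 n h)
    rw [List.map_cons, wedgeList_cons, ih hl.2, createMode_site, create_mulVec_ket _ _ (by simp [hn]),
      -- The new site lies to the left of all others, so its string meets no excitation and no sign
      -- arises.
      exchanges_single_left, Finset.filter_false_of_mem]
    · simp only [Finset.card_empty, pow_zero, one_smul]
      congr 1
      funext m
      by_cases h : m = n
      · subst h; simp
      · simp [h]
    · intro m _ hm
      have : m ∈ l := by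
        by_contra hml
        simp [hml] at hm
      exact lt_asymm hm.1 (hl.1 m this)

theorem wedgeList_excitedSites {N : ℕ} (x : Config N) :
    wedgeList ((excitedSites x).map site) = ket x := by
  rw [wedgeList_site_of_pairwise (excitedSites x) ((List.pairwise_lt_finRange N).filter _)]
  congr 1
  funext n
  simp only [excitedSites, List.mem_filter, List.mem_finRange, true_and, decide_eq_true_eq]
  generalize x n = a
  revert a
  decide

/-! ### Signs of reorderings. -/

theorem createMode_mul_prod {N : ℕ} (v : Fin N → ℂ) (l : List (Fin N → ℂ)) :
    createMode v * (l.map createMode).prod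
      = (-1 : ℂ) ^ l.length • ((l.map createMode).prod * createMode v) := by
  induction l with
  | nil => simp
  | cons w l ih =>
    rw [List.map_cons, List.prod_cons, ← mul_assoc, createMode_mul_comm, neg_mul, mul_assoc, ih,
      List.length_cons, pow_succ, Matrix.mul_smul, mul_assoc]
    module

/-- Moving the first factor behind the other `k` costs `(-1) ^ k`, and `choose (k + 1) 2 = k +
choose k 2`. -/
theorem createMode_prod_reverse {N : ℕ} (l : List (Fin N → ℂ)) :
    (l.reverse.map createMode).prod
      = (-1 : ℂ) ^ l.length.choose 2 • (l.map createMode).prod := by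
  induction l with
  | nil => simp
  | cons v l ih =>
    have h : (-1 : ℂ) ^ l.length * (-1 : ℂ) ^ l.length = 1 := by
      rw [← pow_add, ← two_mul, pow_mul]; simp
    simp only [List.reverse_cons, List.map_append, List.prod_append, ih, List.map_cons, List.map_nil,
      List.prod_cons, List.prod_nil, mul_one, createMode_mul_prod, List.length_cons,
      Nat.choose_succ_succ' _ 1, Nat.choose_one_right, pow_add, smul_smul, Matrix.smul_mul]
    rw [mul_right_comm, h, one_mul]

theorem wedgeList_reverse {N : ℕ} (l : List (Fin N → ℂ)) :
    wedgeList l.reverse = (-1 : ℂ) ^ l.length.choose 2 • wedgeList l := by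
  rw [wedgeList_eq, wedgeList_eq, createMode_prod_reverse, Matrix.smul_mulVec]

theorem card_excited_eq_weight {N : ℕ} (y : Config N) :
    (Finset.univ.filter fun m => y m = 1).card = weight y := by
  rw [weight, excitedSites, ← List.toFinset_card_of_nodup ((List.nodup_finRange N).filter _)]
  congr 1
  ext m
  simp

/-- The two orders count the excitations left and right of `n`. As `y n = 0` whenever the wedge is
nonzero, these counts add up to the weight. -/
theorem wedge_ket_single {N : ℕ} (n : Fin N) (y : Config N) :
    wedge (ket (Pi.single n 1)) (ket y) = (-1 : ℂ) ^ weight y • wedge (ket y) (ket (Pi.single n 1)) := by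
  have hw : ∀ a b : Config N, wedge (ket a) (ket b) = fun z =>
      if ∀ n, (a n : ℕ) + (b n : ℕ) = (z n : ℕ) then (-1 : ℂ) ^ exchanges a b else 0 := by
    intro a b
    funext z
    rw [wedge, Finset.sum_eq_single a, Finset.sum_eq_single b]
    · simp [ket]
    · intro x _ hx; simp [ket, Pi.single_eq_of_ne hx]
    · simp
    · intro x _ hx; simp [ket, Pi.single_eq_of_ne hx]
    · simp
  rw [hw, hw]
  funext z
  simp only [Pi.smul_apply, smul_eq_mul]
  by_cases hz : ∀ m, ((Pi.single n 1 : Config N) m : ℕ) + (y m : ℕ) = (z m : ℕ)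
  · have hn : y n = 0 := by
      have := (single_one_add_eq_iff n y z n).1 (hz n)
      rw [if_pos rfl] at this
      exact this.1
    rw [if_pos hz, if_pos fun m => by rw [add_comm]; exact hz m, exchanges_single_left,
      exchanges_single_right]
    have hcard : weight y = (Finset.univ.filter fun m => m < n ∧ y m = 1).card
        + (Finset.univ.filter fun m => n < m ∧ y m = 1).card := by
      rw [← card_excited_eq_weight, ← Finset.card_union_of_disjoint]
      · congr 1
        ext m
        simp only [Finset.mem_filter, Finset.mem_univ, true_and, Finset.mem_union]
        rcases lt_trichotomy m n with h | h | h
        · simp [h, h.not_gt]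
        · subst h; simp [hn]
        · simp [h, h.not_gt]
      · rw [Finset.disjoint_filter]
        intro m _ h1 h2
        exact lt_asymm h1.1 h2.1
    rw [hcard, pow_add, mul_assoc, ← pow_add, ← two_mul, pow_mul]
    simp
  · rw [if_neg hz, if_neg fun h => hz fun m => by rw [add_comm]; exact h m, mul_zero]

theorem wedge_oneExcitation_ket {N : ℕ} (v : Fin N → ℂ) (y : Config N) :
    wedge (oneExcitation v) (ket y) = (-1 : ℂ) ^ weight y • wedge (ket y) (oneExcitation v) := by
  have h : wedgeLin N (oneExcitation v) (ket y)
      = (-1 : ℂ) ^ weight y • wedgeLin N (ket y) (oneExcitation v) := by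
    simp only [oneExcitation, map_sum, map_smul, LinearMap.sum_apply, LinearMap.smul_apply,
      Finset.smul_sum]
    refine Finset.sum_congr rfl fun n _ => ?_
    rw [smul_comm]
    exact congrArg (v n • ·) (wedge_ket_single n y)
  exact h

/-! Quadratic Hamiltonians. -/

/-- The second quantization `∑ Mᵢⱼ aᵢ† aⱼ` of a one-particle operator `M`. -/
def secondQuantization {N : ℕ} (M : Matrix (Fin N) (Fin N) ℂ) : Op N :=
  ∑ i, ∑ j, M i j • (create i * annihilate j)

theorem secondQuantization_add {N : ℕ} (M K : Matrix (Fin N) (Fin N) ℂ) :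
    secondQuantization (M + K) = secondQuantization M + secondQuantization K := by
  simp [secondQuantization, add_smul, Finset.sum_add_distrib]

theorem secondQuantization_smul {N : ℕ} (c : ℂ) (M : Matrix (Fin N) (Fin N) ℂ) :
    secondQuantization (c • M) = c • secondQuantization M := by
  simp [secondQuantization, Finset.smul_sum, smul_smul]

theorem secondQuantization_sum {N : ℕ} {ι : Type*} (s : Finset ι)
    (M : ι → Matrix (Fin N) (Fin N) ℂ) :
    secondQuantization (∑ k ∈ s, M k) = ∑ k ∈ s, secondQuantization (M k) := by
  classical
  induction s using Finset.induction_on with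
  | empty => simp [secondQuantization]
  | insert k s hk ih => rw [Finset.sum_insert hk, Finset.sum_insert hk, secondQuantization_add, ih]

theorem secondQuantization_single {N : ℕ} (i j : Fin N) :
    secondQuantization (Matrix.single i j 1) = create i * annihilate j := by
  rw [secondQuantization, Finset.sum_eq_single i, Finset.sum_eq_single j]
  · simp
  · intro k _ hk; simp [hk.symm]
  · simp
  · intro k _ hk; simp [hk.symm]
  · simp

theorem secondQuantization_vecMulVec {N : ℕ} (v w : Fin N → ℂ) :
    secondQuantization (Matrix.vecMulVec v (star w)) = createMode v * annihilateMode w := by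
  rw [annihilateMode_eq, createMode, Finset.sum_mul_sum, secondQuantization]
  simp only [Matrix.vecMulVec_apply, Matrix.smul_mul, Matrix.mul_smul, smul_smul, Pi.star_apply]
  refine Finset.sum_congr rfl fun i _ => Finset.sum_congr rfl fun j _ => ?_
  rw [mul_comm]; rfl

theorem hamiltonianJW_eq {N : ℕ} (J : Fin (N - 1) → ℝ) (B : Fin N → ℝ) :
    hamiltonianJW J B = secondQuantization (hamiltonianOne J B) := by
  have hd : (Matrix.diagonal fun n => (2 * B n : ℂ))
      = ∑ n, (2 * B n : ℂ) • Matrix.single n n (1 : ℂ) := by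
    simp only [Matrix.smul_single, smul_eq_mul, mul_one, Matrix.sum_single_eq_diagonal]
  rw [hamiltonianOne, hamiltonianJW, secondQuantization_add, hd]
  simp only [secondQuantization_sum, secondQuantization_smul, secondQuantization_add,
    secondQuantization_single, Finset.smul_sum, smul_smul]
  rw [add_comm]

/-- Moving `createMode v` to the left gives one sign at each of the two operators, which cancel, and
a contraction `v j` with `annihilate j`. -/
theorem create_mul_annihilate_mul_createMode {N : ℕ} (i j : Fin N) (v : Fin N → ℂ) :
    create i * annihilate j * createMode v
      = createMode v * (create i * annihilate j) + v j • create i := by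
  have h1 : annihilate j * createMode v = v j • (1 : Op N) - createMode v * annihilate j := by
    rw [eq_sub_iff_add_eq, createMode, Finset.mul_sum, Finset.sum_mul, ← Finset.sum_add_distrib,
      Finset.sum_eq_single j]
    · rw [Matrix.mul_smul, Matrix.smul_mul, ← smul_add, annihilate_anticomm_create, if_pos rfl]
    · intro k _ hk
      rw [Matrix.mul_smul, Matrix.smul_mul, ← smul_add, annihilate_anticomm_create, if_neg hk.symm,
        smul_zero]
    · simp
  have h2 : create i * createMode v = -(createMode v * create i) := by
    rw [← createMode_site, createMode_mul_comm]
  rw [mul_assoc, h1, mul_sub, ← mul_assoc, h2, Matrix.mul_smul, mul_one, neg_mul, mul_assoc,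
    sub_neg_eq_add, add_comm]

/-- Second quantization acts as a derivation on products of creation operators; energies of
independent modes therefore add. -/
theorem secondQuantization_mul_createMode {N : ℕ} (M : Matrix (Fin N) (Fin N) ℂ)
    (v : Fin N → ℂ) :
    secondQuantization M * createMode v
      = createMode v * secondQuantization M + createMode (M *ᵥ v) := by
  have h : createMode (M *ᵥ v) = ∑ i, ∑ j, M i j • v j • create i := by
    rw [createMode]
    simp only [Matrix.mulVec, dotProduct, Finset.sum_smul, smul_smul]
  rw [h]
  simp only [secondQuantization, Finset.sum_mul, Finset.mul_sum, ← Finset.sum_add_distrib,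
    Matrix.smul_mul, Matrix.mul_smul, create_mul_annihilate_mul_createMode, smul_add]

theorem secondQuantization_mulVec_vacuum {N : ℕ} (M : Matrix (Fin N) (Fin N) ℂ) :
    secondQuantization M *ᵥ vacuum N = 0 := by
  simp [secondQuantization, Matrix.sum_mulVec, Matrix.smul_mulVec, ← Matrix.mulVec_mulVec,
    annihilate_mulVec_vacuum]

theorem secondQuantization_mulVec_oneExcitation {N : ℕ} (M : Matrix (Fin N) (Fin N) ℂ)
    (a : Fin N → ℂ) :
    secondQuantization M *ᵥ oneExcitation a = oneExcitation (M *ᵥ a) := by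
  rw [← createMode_mulVec_vacuum, Matrix.mulVec_mulVec, secondQuantization_mul_createMode,
    Matrix.add_mulVec, ← Matrix.mulVec_mulVec, secondQuantization_mulVec_vacuum, Matrix.mulVec_zero,
    zero_add, createMode_mulVec_vacuum]

theorem secondQuantization_mulVec_wedgeList {N : ℕ} {ι : Type*} (M : Matrix (Fin N) (Fin N) ℂ)
    (lam : ι → ℂ) (v : ι → Fin N → ℂ) (h : ∀ n, M *ᵥ v n = lam n • v n) (l : List ι) :
    secondQuantization M *ᵥ wedgeList (l.map v) = (l.map lam).sum • wedgeList (l.map v) := by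
  induction l with
  | nil => simp [wedgeList_nil, secondQuantization_mulVec_vacuum]
  | cons n l ih =>
    rw [List.map_cons, wedgeList_cons, Matrix.mulVec_mulVec, secondQuantization_mul_createMode,
      Matrix.add_mulVec, ← Matrix.mulVec_mulVec, ih, h, createMode_smul, Matrix.mulVec_smul,
      Matrix.smul_mulVec, List.map_cons, List.sum_cons, add_smul, add_comm]

/-! The one-particle matrix and its eigenbases. -/

theorem hamiltonianOne_transpose {N : ℕ} (J : Fin (N - 1) → ℝ) (B : Fin N → ℝ) :
    (hamiltonianOne J B)ᵀ = hamiltonianOne J B := by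
  simp [hamiltonianOne, Matrix.transpose_sum, add_comm]

theorem hamiltonianOne_isHermitian {N : ℕ} (J : Fin (N - 1) → ℝ) (B : Fin N → ℝ) :
    (hamiltonianOne J B).IsHermitian := by
  rw [Matrix.IsHermitian, hamiltonianOne, Matrix.conjTranspose_add,
    Matrix.diagonal_conjTranspose, Matrix.conjTranspose_sum]
  congr 1
  · congr 1; funext n; simp
  · refine Finset.sum_congr rfl fun n _ => ?_
    simp [Matrix.conjTranspose_single, add_comm]

theorem exists_isEigenbasis {N : ℕ} (J : Fin (N - 1) → ℝ) (B : Fin N → ℝ) :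
    ∃ lam v, IsEigenbasis J B lam v :=
  ⟨(hamiltonianOne_isHermitian J B).eigenvalues, (hamiltonianOne_isHermitian J B).eigenvectorBasis,
    fun n => by
      rw [Matrix.IsHermitian.mulVec_eigenvectorBasis, Complex.coe_smul]⟩

theorem orthonormalBasis_expand {N : ℕ} (b : OrthonormalBasis (Fin N) ℂ (EuclideanSpace ℂ (Fin N)))
    (v : Fin N → ℂ) : ∃ c : Fin N → ℂ, v = ∑ n, c n • (b n).ofLp := by
  refine ⟨fun n => b.repr (WithLp.toLp 2 v) n, ?_⟩
  have h := congrArg WithLp.ofLp (b.sum_repr (WithLp.toLp 2 v))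
  simpa using h.symm

theorem orthonormalBasis_sum_conj_mul {N : ℕ}
    (b : OrthonormalBasis (Fin N) ℂ (EuclideanSpace ℂ (Fin N))) (m n : Fin N) :
    ∑ k, conj ((b m).ofLp k) * (b n).ofLp k = if m = n then 1 else 0 := by
  rw [← orthonormal_iff_ite.1 b.orthonormal m n]
  simp [PiLp.inner_apply, mul_comm]

/-- Both sides act alike on the eigenbasis. Second quantizing this spectral decomposition gives the
sum over independent modes. -/
theorem eq_sum_vecMulVec_of_eigenbasis {N : ℕ} (M : Matrix (Fin N) (Fin N) ℂ) (lam : Fin N → ℂ)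
    (b : OrthonormalBasis (Fin N) ℂ (EuclideanSpace ℂ (Fin N)))
    (h : ∀ n, M *ᵥ (b n).ofLp = lam n • (b n).ofLp) :
    M = ∑ n, lam n • Matrix.vecMulVec (b n).ofLp (star (b n).ofLp) := by
  have hb : ∀ n, (∑ k, lam k • Matrix.vecMulVec (b k).ofLp (star (b k).ofLp)) *ᵥ (b n).ofLp
      = lam n • (b n).ofLp := by
    intro n
    have hd : ∀ k, star (b k).ofLp ⬝ᵥ (b n).ofLp = if k = n then 1 else 0 :=
      fun k => orthonormalBasis_sum_conj_mul b k n
    simp [Matrix.sum_mulVec, Matrix.smul_mulVec, Matrix.vecMulVec_mulVec, hd]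
  refine Matrix.mulVec_injective ?_
  funext v
  obtain ⟨c, rfl⟩ := orthonormalBasis_expand b v
  simp only [Matrix.mulVec_sum, Matrix.mulVec_smul, h, hb]

/-! Time evolution. -/

/-- The relation passes to all powers and so to the exponential series. The norm chosen here is
auxiliary. -/
theorem exp_mul_of_mul_eq {ι : Type*} [Fintype ι] [DecidableEq ι] {A C M : Matrix ι ι ℂ}
    (h : A * M = M * C) : NormedSpace.exp A * M = M * NormedSpace.exp C := by
  let _ : NormedRing (Matrix ι ι ℂ) := Matrix.linftyOpNormedRing
  let _ : NormedAlgebra ℂ (Matrix ι ι ℂ) := Matrix.linftyOpNormedAlgebra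
  let _ : NormedAlgebra ℚ (Matrix ι ι ℂ) := NormedAlgebra.restrictScalars ℚ ℂ _
  have : CompleteSpace (Matrix ι ι ℂ) := FiniteDimensional.complete ℂ _
  have hs : SemiconjBy M C A := h.symm
  exact hs.exp_right.eq.symm

theorem exp_smul_one {ι : Type*} [Fintype ι] [DecidableEq ι] (c : ℂ) :
    NormedSpace.exp (c • (1 : Matrix ι ι ℂ)) = Complex.exp c • (1 : Matrix ι ι ℂ) := by
  rw [Matrix.smul_one_eq_diagonal, Matrix.exp_diagonal, Matrix.smul_one_eq_diagonal,
    Complex.exp_eq_exp_ℂ]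
  congr 1
  funext i
  rw [Pi.coe_exp]

theorem exp_mulVec_of_eigenvector {ι : Type*} [Fintype ι] [DecidableEq ι] {A : Matrix ι ι ℂ}
    {v : ι → ℂ} {c : ℂ} (h : A *ᵥ v = c • v) :
    NormedSpace.exp A *ᵥ v = Complex.exp c • v := by
  -- The eigenvector equation becomes an intertwining relation for a rank-one matrix; a nonzero
  -- coordinate of `v` is cancelled at the end.
  have hM : A * Matrix.vecMulVec v v = Matrix.vecMulVec v v * (c • (1 : Matrix ι ι ℂ)) := by
    rw [Matrix.mul_vecMulVec, h, Matrix.mul_smul, mul_one, Matrix.smul_vecMulVec]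
  have h2 := exp_mul_of_mul_eq hM
  rw [exp_smul_one, Matrix.mul_vecMulVec, Matrix.mul_smul, mul_one, ← Matrix.smul_vecMulVec] at h2
  by_cases hv : v = 0
  · simp [hv]
  · obtain ⟨j, hj⟩ := Function.ne_iff.1 hv
    funext i
    exact mul_right_cancel₀ hj (congrFun (congrFun h2 i) j)

/-- For an eigenvector, passing `createMode v` shifts the second quantized operator by a scalar,
which exponentiates to the phase acquired by `v`. -/
theorem exp_secondQuantization_mul_createMode {N : ℕ} {M : Matrix (Fin N) (Fin N) ℂ}
    {v : Fin N → ℂ} {c : ℂ} (s : ℂ) (h : M *ᵥ v = c • v) :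
    NormedSpace.exp (s • secondQuantization M) * createMode v
      = createMode (NormedSpace.exp (s • M) *ᵥ v) * NormedSpace.exp (s • secondQuantization M) := by
  have h1 : (s • secondQuantization M) * createMode v
      = createMode v * (s • secondQuantization M + (s * c) • (1 : Op N)) := by
    rw [Matrix.smul_mul, secondQuantization_mul_createMode, h, createMode_smul, mul_add,
      Matrix.mul_smul, Matrix.mul_smul, mul_one, smul_add, smul_smul]
  have h2 : (s • M) *ᵥ v = (s * c) • v := by rw [Matrix.smul_mulVec, h, smul_smul]
  rw [exp_mul_of_mul_eq h1, exp_mulVec_of_eigenvector h2, createMode_smul,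
    Matrix.exp_add_of_commute _ _ ((Commute.one_right _).smul_right _), exp_smul_one,
    Matrix.mul_smul, mul_one, Matrix.mul_smul, Matrix.smul_mul]

theorem evolution_hamiltonian {N : ℕ} (J : Fin (N - 1) → ℝ) (B : Fin N → ℝ) (t : ℝ) :
    evolution (hamiltonian J B) t = Complex.exp (Complex.I * t * ∑ n, (B n : ℂ)) •
      NormedSpace.exp ((-(Complex.I * t)) • secondQuantization (hamiltonianOne J B)) := by
  have h : (-(Complex.I * t)) • hamiltonian J B
      = (-(Complex.I * t)) • secondQuantization (hamiltonianOne J B)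
        + (Complex.I * t * ∑ n, (B n : ℂ)) • (1 : Op N) := by
    rw [hamiltonian_eq, hamiltonianJW_eq]
    module
  rw [evolution, h, Matrix.exp_add_of_commute _ _ ((Commute.one_right _).smul_right _),
    exp_smul_one, Matrix.mul_smul, mul_one]

theorem evolution_mul_createMode {N : ℕ} (J : Fin (N - 1) → ℝ) (B : Fin N → ℝ) (t : ℝ)
    (v : Fin N → ℂ) :
    evolution (hamiltonian J B) t * createMode v
      = createMode (evolution (hamiltonianOne J B) t *ᵥ v) * evolution (hamiltonian J B) t := by
  -- Both sides are linear in `v`, so eigenvectors suffice.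
  obtain ⟨lam, b, hb⟩ := exists_isEigenbasis J B
  obtain ⟨c, rfl⟩ := orthonormalBasis_expand b v
  simp only [Matrix.mulVec_sum, Matrix.mulVec_smul, createMode_sum, createMode_smul, Finset.mul_sum,
    Finset.sum_mul, Matrix.mul_smul, Matrix.smul_mul]
  refine Finset.sum_congr rfl fun n _ => ?_
  rw [evolution_hamiltonian, Matrix.smul_mul, exp_secondQuantization_mul_createMode _ (hb n),
    Matrix.mul_smul, evolution]

theorem evolution_mulVec_vacuum {N : ℕ} (J : Fin (N - 1) → ℝ) (B : Fin N → ℝ) (t : ℝ) :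
    evolution (hamiltonian J B) t *ᵥ vacuum N
      = Complex.exp (Complex.I * t * ∑ n, (B n : ℂ)) • vacuum N := by
  have h : ((-(Complex.I * t)) • secondQuantization (hamiltonianOne J B)) *ᵥ vacuum N
      = (0 : ℂ) • vacuum N := by
    rw [Matrix.smul_mulVec, secondQuantization_mulVec_vacuum, smul_zero, zero_smul]
  rw [evolution_hamiltonian, Matrix.smul_mulVec, exp_mulVec_of_eigenvector h, Complex.exp_zero,
    one_smul]

theorem evolution_mulVec_wedgeList {N : ℕ} (J : Fin (N - 1) → ℝ) (B : Fin N → ℝ) (t : ℝ)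
    (l : List (Fin N → ℂ)) :
    evolution (hamiltonian J B) t *ᵥ wedgeList l
      = Complex.exp (Complex.I * t * ∑ n, (B n : ℂ)) •
        wedgeList (l.map fun a => evolution (hamiltonianOne J B) t *ᵥ a) := by
  induction l with
  | nil => exact evolution_mulVec_vacuum J B t
  | cons v l ih =>
    rw [wedgeList_cons, Matrix.mulVec_mulVec, evolution_mul_createMode, ← Matrix.mulVec_mulVec, ih,
      List.map_cons, wedgeList_cons, Matrix.mulVec_smul]

theorem wedgeList_singleton {N : ℕ} (a : Fin N → ℂ) : wedgeList [a] = oneExcitation a := by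
  rw [wedgeList_cons, wedgeList_nil, createMode_mulVec_vacuum]

theorem wedgeList_pair {N : ℕ} (a b : Fin N → ℂ) :
    wedgeList [a, b] = wedge (oneExcitation a) (oneExcitation b) := by
  rw [wedgeList_cons, wedgeList_singleton, wedge_oneExcitation]

theorem wedgeList_smul {N : ℕ} (c : ℂ) (l : List (Fin N → ℂ)) :
    wedgeList (l.map fun v => c • v) = c ^ l.length • wedgeList l := by
  induction l with
  | nil => simp
  | cons v l ih =>
    rw [List.map_cons, wedgeList_cons, ih, createMode_smul, Matrix.mulVec_smul, Matrix.smul_mulVec,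
      wedgeList_cons, List.length_cons, pow_succ, smul_smul]

theorem evolution_mem_unitary {ι : Type*} [Fintype ι] [DecidableEq ι] {A : Matrix ι ι ℂ}
    (hA : A.IsHermitian) (t : ℝ) : (evolution A t)ᴴ * evolution A t = 1 := by
  have h : ((-(Complex.I * t)) • A)ᴴ = -((-(Complex.I * t)) • A) := by
    rw [Matrix.conjTranspose_smul, hA.eq]
    simp
  rw [evolution, ← Matrix.exp_conjTranspose, h, ← Matrix.exp_add_of_commute _ _ (Commute.refl ((-(Complex.I * t)) • A)).neg_left,
    neg_add_cancel, NormedSpace.exp_zero]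

/-- Symmetry of the propagator, as distinct from unitarity, is what turns transfer to the last site
into transfer back with the same phase. -/
theorem evolution_transpose {ι : Type*} [Fintype ι] [DecidableEq ι] {A : Matrix ι ι ℂ}
    (hA : Aᵀ = A) (t : ℝ) : (evolution A t)ᵀ = evolution A t := by
  rw [evolution, ← Matrix.exp_transpose, Matrix.transpose_smul, hA]

theorem evolution_mul_comm {ι : Type*} [Fintype ι] [DecidableEq ι] {A M : Matrix ι ι ℂ}
    (h : A * M = M * A) (t : ℝ) : evolution A t * M = M * evolution A t :=
  exp_mul_of_mul_eq (by rw [Matrix.smul_mul, Matrix.mul_smul, h])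

/-! Mirroring of single excitations. -/

theorem hamiltonianOne_apply_of_ne {N : ℕ} (J : Fin (N - 1) → ℝ) (B : Fin N → ℝ) {i j : Fin N}
    (hij : i ≠ j) :
    hamiltonianOne J B i j = ∑ n, (J n : ℂ) * ((if leftSite n = i ∧ rightSite n = j then 1 else 0)
      + (if rightSite n = i ∧ leftSite n = j then 1 else 0)) := by
  simp only [hamiltonianOne, Matrix.add_apply, Matrix.diagonal_apply_ne _ hij, zero_add,
    Matrix.sum_apply, Matrix.smul_apply, smul_eq_mul, Matrix.single_apply]

theorem hamiltonianOne_apply_of_far {N : ℕ} (J : Fin (N - 1) → ℝ) (B : Fin N → ℝ) {i j : Fin N}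
    (h : (i : ℕ) + 1 < j ∨ (j : ℕ) + 1 < i) : hamiltonianOne J B i j = 0 := by
  have hij : i ≠ j := by rintro rfl; omega
  rw [hamiltonianOne_apply_of_ne J B hij]
  refine Finset.sum_eq_zero fun n _ => ?_
  simp only [leftSite, rightSite, Fin.ext_iff]
  rw [if_neg (by omega), if_neg (by omega), add_zero, mul_zero]

theorem hamiltonianOne_apply_right_left {N : ℕ} (J : Fin (N - 1) → ℝ) (B : Fin N → ℝ)
    (n : Fin (N - 1)) : hamiltonianOne J B (rightSite n) (leftSite n) = J n := by
  rw [hamiltonianOne_apply_of_ne J B (leftSite_lt_rightSite n).ne', Finset.sum_eq_single n]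
  · rw [if_neg fun h => (leftSite_lt_rightSite n).ne h.1, if_pos ⟨rfl, rfl⟩, zero_add, mul_one]
  · intro m _ hm
    have : (m : ℕ) ≠ n := fun h => hm (Fin.ext h)
    simp only [leftSite, rightSite, Fin.ext_iff]
    rw [if_neg (by omega), if_neg (by omega), add_zero, mul_zero]
  · simp

theorem hamiltonianOne_apply_comm {N : ℕ} (J : Fin (N - 1) → ℝ) (B : Fin N → ℝ) (i j : Fin N) :
    hamiltonianOne J B i j = hamiltonianOne J B j i := by
  conv_lhs => rw [← hamiltonianOne_transpose]
  rfl

theorem hamiltonianOne_apply_left_right {N : ℕ} (J : Fin (N - 1) → ℝ) (B : Fin N → ℝ)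
    (n : Fin (N - 1)) : hamiltonianOne J B (leftSite n) (rightSite n) = J n := by
  rw [hamiltonianOne_apply_comm, hamiltonianOne_apply_right_left]

theorem rev_rightSite {N : ℕ} (n : Fin (N - 1)) : (rightSite n).rev = leftSite n.rev := by
  ext; simp [leftSite, rightSite, Fin.val_rev]; omega

theorem rev_leftSite {N : ℕ} (n : Fin (N - 1)) : (leftSite n).rev = rightSite n.rev := by
  ext; simp [leftSite, rightSite, Fin.val_rev]; omega

theorem mulVec_site {N : ℕ} (M : Matrix (Fin N) (Fin N) ℂ) (n i : Fin N) :
    (M *ᵥ site n) i = M i n := by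
  simp [site]

theorem exp_I_mul_conj (r : ℝ) :
    Complex.exp (Complex.I * r) * conj (Complex.exp (Complex.I * r)) = 1 := by
  rw [← Complex.exp_conj, ← Complex.exp_add]
  simp

theorem exp_I_mul_sum_mul_conj {N : ℕ} (t : ℝ) (B : Fin N → ℝ) :
    Complex.exp (Complex.I * t * ∑ n, (B n : ℂ))
      * conj (Complex.exp (Complex.I * t * ∑ n, (B n : ℂ))) = 1 := by
  have h1 := exp_I_mul_conj (t * ∑ n, B n)
  have h2 : Complex.I * ((t * ∑ n, B n : ℝ) : ℂ) = Complex.I * t * ∑ n, (B n : ℂ) := by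
    push_cast; ring
  rwa [h2] at h1

theorem rev_firstSite {N : ℕ} (hN : 2 ≤ N) : (firstSite hN).rev = lastSite hN := by
  ext; simp [firstSite, lastSite, Fin.val_rev]

theorem rev_nextToLastSite {N : ℕ} (hN : 2 ≤ N) : (nextToLastSite hN).rev = secondSite hN := by
  ext; simp [secondSite, nextToLastSite, Fin.val_rev]; omega

theorem rev_secondSite {N : ℕ} (hN : 2 ≤ N) : (secondSite hN).rev = nextToLastSite hN := by
  rw [← rev_nextToLastSite, Fin.rev_rev]

section PerfectTransfer

variable {N : ℕ} {hN : 2 ≤ N} {J : Fin (N - 1) → ℝ} {B : Fin N → ℝ} {t₀ φ : ℝ}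

/-- On a chain with perfect transfer, no coupling vanishes. -/
theorem IsPerfectTransfer.coupling_ne_zero (h : IsPerfectTransfer hN J B t₀ φ) (k : Fin (N - 1)) :
    J k ≠ 0 := by
  intro hk
  set U := evolution (hamiltonianOne J B) t₀ with hU
  -- If the coupling vanishes, the matrix splits into two blocks; `d` is the indicator of the left
  -- block, and the propagator preserves it.
  set d : Fin N → ℂ := fun i => if i ≤ leftSite k then 1 else 0 with hd
  have hcomm : hamiltonianOne J B * Matrix.diagonal d = Matrix.diagonal d * hamiltonianOne J B := by
    ext i j
    rw [Matrix.mul_diagonal, Matrix.diagonal_mul]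
    have key : ∀ a b : Fin N, a ≤ leftSite k → ¬ b ≤ leftSite k → hamiltonianOne J B a b = 0 := by
      intro a b ha hb
      by_cases hab : a = leftSite k ∧ b = rightSite k
      · rw [hab.1, hab.2, hamiltonianOne_apply_left_right, hk, Complex.ofReal_zero]
      · apply hamiltonianOne_apply_of_far
        simp only [leftSite, rightSite, Fin.ext_iff, Fin.le_def] at *
        omega
    by_cases hi : i ≤ leftSite k <;> by_cases hj : j ≤ leftSite k
    · simp [hd, hi, hj]
    · simp [hd, hi, hj, key i j hi hj]
    · rw [hamiltonianOne_apply_comm, key j i hj hi, zero_mul, mul_zero]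
    · simp [hd, hi, hj]
  -- The entry from the first to the last site joins different blocks, yet it is a phase.
  have h1 := congrFun (congrFun (evolution_mul_comm hcomm t₀) (lastSite hN)) (firstSite hN)
  rw [← hU, Matrix.mul_diagonal, Matrix.diagonal_mul, ← mulVec_site U, hU, h] at h1
  have h0 : firstSite hN ≤ leftSite k := by simp [firstSite, Fin.le_def]
  have h2 : ¬ lastSite hN ≤ leftSite k := by
    simp only [lastSite, leftSite, Fin.le_def]; omega
  simp [hd, h0, h2, site] at h1

/-- Unitarity determines the last row of the propagator, and symmetry makes it the last column. No
sign condition on the couplings enters. -/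
theorem IsPerfectTransfer.transfer_back (h : IsPerfectTransfer hN J B t₀ φ) :
    evolution (hamiltonianOne J B) t₀ *ᵥ site (lastSite hN)
      = Complex.exp (Complex.I * φ) • site (firstSite hN) := by
  set U := evolution (hamiltonianOne J B) t₀ with hU
  have hUU : Uᴴ * U = 1 := evolution_mem_unitary (hamiltonianOne_isHermitian J B) t₀
  have h1 : Uᴴ *ᵥ (U *ᵥ site (firstSite hN)) = site (firstSite hN) := by
    rw [Matrix.mulVec_mulVec, hUU, Matrix.one_mulVec]
  rw [hU, h, ← hU, Matrix.mulVec_smul] at h1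
  funext i
  have h2 := congrFun h1 i
  have hs : U (lastSite hN) i = U i (lastSite hN) :=
    congrFun (congrFun (evolution_transpose (hamiltonianOne_transpose J B) t₀) i) (lastSite hN)
  rw [Pi.smul_apply, mulVec_site, Matrix.conjTranspose_apply, hs, smul_eq_mul] at h2
  have h3 := congrArg conj h2
  have hp := exp_I_mul_conj φ
  have hc : conj (site (firstSite hN) i) = site (firstSite hN) i := by
    simp only [site, Pi.single_apply]; split_ifs <;> simp
  rw [map_mul, hc, starRingEnd_apply, starRingEnd_apply, star_star] at h3
  rw [starRingEnd_apply] at hp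
  rw [mulVec_site, Pi.smul_apply, smul_eq_mul, ← h3, ← mul_assoc, hp, one_mul]

/-- Perfect transfer mirrors every single excitation if mirrored couplings have equal signs. -/
theorem IsPerfectTransfer.mirror (h : IsPerfectTransfer hN J B t₀ φ)
    (hJ : ∀ n, 0 ≤ J n * J n.rev) (n : Fin N) :
    evolution (hamiltonianOne J B) t₀ *ᵥ site n = Complex.exp (Complex.I * φ) • site n.rev := by
  set U := evolution (hamiltonianOne J B) t₀ with hU
  set p := Complex.exp (Complex.I * φ) with hp
  have hpp : p * conj p = 1 := exp_I_mul_conj φ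
  have hp0 : p ≠ 0 := Complex.exp_ne_zero _
  have hUU : Uᴴ * U = 1 := evolution_mem_unitary (hamiltonianOne_isHermitian J B) t₀
  have hUH : hamiltonianOne J B * U = U * hamiltonianOne J B := by
    rw [hU]; exact (evolution_mul_comm rfl t₀).symm
  -- Strong induction on the column; column zero is the hypothesis of perfect transfer.
  suffices H : ∀ k : ℕ, ∀ m : Fin N, (m : ℕ) = k → ∀ i, U i m = if i = m.rev then p else 0 by
    funext i
    rw [mulVec_site, H n n rfl i]
    simp [site, Pi.single_apply]
  intro k
  induction k using Nat.strong_induction_on with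
  | _ k ih =>
  intro m hm i
  rcases Nat.eq_zero_or_pos k with rfl | hk
  · have hm0 : m = firstSite hN := Fin.ext hm
    subst hm0
    rw [rev_firstSite, ← mulVec_site U, hU, h]
    simp [site, Pi.single_apply, ← hp]
  · let b : Fin (N - 1) := ⟨k - 1, by omega⟩
    have hmb : m = rightSite b := by ext; simp [rightSite, b]; omega
    have hcol : ∀ j : Fin N, j < m → ∀ i, U i j = if i = j.rev then p else 0 :=
      fun j hj => ih j (by rw [← hm]; exact hj) j rfl
    have hlm : leftSite b < m := hmb ▸ leftSite_lt_rightSite b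
    -- Column `m` is orthogonal to the earlier columns, which are multiples of mirrored sites.
    have hlow : ∀ j : Fin N, j < m → U j.rev m = 0 := by
      intro j hj
      have h1 := congrFun (congrFun hUU j) m
      rw [Matrix.mul_apply, Matrix.one_apply_ne hj.ne, Finset.sum_eq_single j.rev] at h1
      · rw [Matrix.conjTranspose_apply, hcol j hj, if_pos rfl] at h1
        exact (mul_eq_zero.1 h1).resolve_left (star_ne_zero.2 hp0)
      · intro i _ hi
        rw [Matrix.conjTranspose_apply, hcol j hj, if_neg hi, star_zero, zero_mul]
      · simp
    -- The commutation relation in column `leftSite b`: in `U * H` the columns before `m` vanish in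
    -- this row by induction, and those beyond `m` are out of reach of the tridiagonal matrix.
    have hrec : ∀ j : Fin N, m ≤ j →
        U j.rev m * J b = hamiltonianOne J B j.rev (leftSite b).rev * p := by
      intro j hj
      have h1 := congrFun (congrFun hUH j.rev) (leftSite b)
      rw [Matrix.mul_apply, Matrix.mul_apply, Finset.sum_eq_single (leftSite b).rev,
        Finset.sum_eq_single m, hcol _ hlm, if_pos rfl] at h1
      · rw [h1, ← hamiltonianOne_apply_right_left J B b, hmb]
      · intro i _ hi
        rcases lt_or_gt_of_ne hi with hi | hi
        · rw [hcol i hi, if_neg, zero_mul]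
          intro hji
          have := Fin.rev_injective hji
          subst this
          exact absurd hi hj.not_gt
        · rw [hamiltonianOne_apply_of_far J B (Or.inr _), mul_zero]
          rw [hmb] at hi
          simpa [leftSite, rightSite, Fin.lt_def] using hi
      · simp
      · intro i _ hi
        rw [hcol _ hlm, if_neg hi, mul_zero]
      · simp
    have hJb : (J b : ℂ) ≠ 0 := by exact_mod_cast h.coupling_ne_zero b
    have hoff : ∀ i, i ≠ m.rev → U i m = 0 := by
      intro i hi
      obtain ⟨j, rfl⟩ : ∃ j : Fin N, i = j.rev := ⟨i.rev, (Fin.rev_rev i).symm⟩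
      have hjm : j ≠ m := fun h => hi (by rw [h])
      rcases lt_or_gt_of_ne hjm with hj | hj
      · exact hlow j hj
      · have h1 := hrec j hj.le
        rw [hamiltonianOne_apply_of_far J B (Or.inl _), zero_mul] at h1
        · exact (mul_eq_zero.1 h1).resolve_right hJb
        · rw [hmb] at hj
          simp only [leftSite, rightSite, Fin.lt_def, Fin.val_rev] at *
          omega
    split_ifs with hi
    · rw [hi]
      have h1 := hrec m le_rfl
      have h2 : U m.rev m * J b = J b.rev * p := by
        rw [h1, hmb, rev_rightSite, rev_leftSite, hamiltonianOne_apply_left_right]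
      have h3 : conj (U m.rev m) * U m.rev m = 1 := by
        have h4 := congrFun (congrFun hUU m) m
        rw [Matrix.mul_apply, Matrix.one_apply_eq, Finset.sum_eq_single m.rev] at h4
        · exact h4
        · intro i _ hi'
          rw [hoff i hi', mul_zero]
        · simp
      -- The remaining entry has modulus one, so mirrored couplings have equal squares; the sign
      -- hypothesis then makes them equal, and the entry is `p` rather than `-p`.
      have h5 : (J b : ℂ) * J b = J b.rev * J b.rev := by
        have h6 := congrArg conj h2
        simp only [map_mul, Complex.conj_ofReal] at h6
        calc (J b : ℂ) * J b = (conj (U m.rev m) * J b) * (U m.rev m * J b) := by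
              linear_combination (-(J b : ℂ) * J b) * h3
          _ = J b.rev * J b.rev := by
              rw [h6, h2]; linear_combination ((J b.rev : ℂ) * J b.rev) * hpp
      have h6 : J b = J b.rev := by
        have h7 : J b * J b = J b.rev * J b.rev := by exact_mod_cast h5
        rcases mul_self_eq_mul_self_iff.1 h7 with h8 | h8
        · exact h8
        · have h9 := hJ b
          have h10 := h.coupling_ne_zero b
          rw [← neg_eq_iff_eq_neg.2 h8, mul_neg] at h9
          have := mul_self_pos.2 h10
          linarith
      rw [← h6, mul_comm (J b : ℂ)] at h2
      exact mul_right_cancel₀ hJb h2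
    · exact hoff i hi

/-! Mirroring of several excitations. -/

theorem excitedSites_rev (x : Config N) :
    excitedSites (fun n => x n.rev) = ((excitedSites x).map Fin.rev).reverse := by
  rw [excitedSites, excitedSites, ← List.map_reverse, ← List.filter_reverse, List.finRange_reverse,
    List.filter_map, List.map_map]
  simp [Function.comp_def]

theorem weight_rev (x : Config N) : weight (fun n => x n.rev) = weight x := by
  rw [weight, excitedSites_rev, List.length_reverse, List.length_map, weight]

theorem IsPerfectTransfer.mirror_wedgeList (h : IsPerfectTransfer hN J B t₀ φ)
    (hJ : ∀ n, 0 ≤ J n * J n.rev) (l : List (Fin N)) :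
    evolution (hamiltonian J B) t₀ *ᵥ wedgeList (l.map site)
      = (Complex.exp (Complex.I * t₀ * ∑ n, (B n : ℂ)) * Complex.exp (Complex.I * φ) ^ l.length) •
        wedgeList (l.map fun n => site n.rev) := by
  have hl : (l.map fun n => Complex.exp (Complex.I * φ) • site (n.rev))
      = (l.map fun n => site n.rev).map fun v => Complex.exp (Complex.I * φ) • v := by
    rw [List.map_map]; rfl
  rw [evolution_mulVec_wedgeList, List.map_map]
  simp only [Function.comp_def, h.mirror hJ]
  rw [hl, wedgeList_smul, smul_smul, List.length_map]

/-- Mirroring the sites of an ordered wedge puts them in decreasing order; restoring the order gives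
the binomial sign. -/
theorem IsPerfectTransfer.mirror_ket (h : IsPerfectTransfer hN J B t₀ φ)
    (hJ : ∀ n, 0 ≤ J n * J n.rev) (x : Config N) :
    evolution (hamiltonian J B) t₀ *ᵥ ket x
      = (Complex.exp (Complex.I * t₀ * ∑ n, (B n : ℂ)) * Complex.exp (Complex.I * φ) ^ weight x
          * (-1 : ℂ) ^ (weight x).choose 2) • ket (fun n => x n.rev) := by
  have h1 : ket (fun n => x n.rev) = (-1 : ℂ) ^ (weight x).choose 2 •
      wedgeList ((excitedSites x).map fun n => site n.rev) := by
    rw [← wedgeList_excitedSites, excitedSites_rev, List.map_reverse, wedgeList_reverse,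
      List.length_map, List.length_map, ← weight, List.map_map]
    rfl
  have h2 : (-1 : ℂ) ^ (weight x).choose 2 * (-1 : ℂ) ^ (weight x).choose 2 = 1 := by
    rw [← pow_add, ← two_mul, pow_mul]; simp
  rw [h1, smul_smul, mul_assoc _ _ ((-1 : ℂ) ^ (weight x).choose 2), h2, mul_one,
    ← wedgeList_excitedSites x]
  exact h.mirror_wedgeList hJ (excitedSites x)

theorem IsPerfectTransfer.mirror_wedge_ket (h : IsPerfectTransfer hN J B t₀ φ)
    (hJ : ∀ n, 0 ≤ J n * J n.rev) (α β : ℂ) (x : Config N) :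
    evolution (hamiltonian J B) t₀ *ᵥ wedge
        (oneExcitation (α • site (firstSite hN) + β • site (secondSite hN))) (ket x)
      = (Complex.exp (Complex.I * t₀ * ∑ n, (B n : ℂ))
          * Complex.exp (Complex.I * φ) ^ (weight x + 1) * (-1 : ℂ) ^ (weight x).choose 2) •
        wedge (oneExcitation (α • site (lastSite hN) + β • site (nextToLastSite hN)))
          (ket (fun n => x n.rev)) := by
  have h1 : evolution (hamiltonianOne J B) t₀ *ᵥ (α • site (firstSite hN) + β • site (secondSite hN))
      = Complex.exp (Complex.I * φ) • (α • site (lastSite hN) + β • site (nextToLastSite hN)) := by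
    rw [Matrix.mulVec_add, Matrix.mulVec_smul, Matrix.mulVec_smul, h.mirror hJ, h.mirror hJ,
      rev_firstSite, rev_secondSite]
    module
  rw [wedge_oneExcitation, wedge_oneExcitation, Matrix.mulVec_mulVec, evolution_mul_createMode,
    ← Matrix.mulVec_mulVec, h.mirror_ket hJ, h1, createMode_smul, Matrix.mulVec_smul,
    Matrix.smul_mulVec, smul_smul]
  congr 1
  ring

/-! Entanglement generation. -/

/-- The configuration with bits `a`, `b` on the first and last site and zeros elsewhere. -/
def endsConfig (hN : 2 ≤ N) (a b : Fin 2) : Config N := fun n =>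
  if n = firstSite hN then a else if n = lastSite hN then b else 0

theorem firstSite_lt_lastSite (hN : 2 ≤ N) : firstSite hN < lastSite hN := by
  simp only [firstSite, lastSite, Fin.lt_def]; omega

theorem eq_endsConfig_iff (hN : 2 ≤ N) (a b : Fin 2) (x : Config N) :
    x = endsConfig hN a b ↔ (∀ n, n ≠ firstSite hN → n ≠ lastSite hN → x n = 0)
      ∧ x (firstSite hN) = a ∧ x (lastSite hN) = b := by
  have hne := (firstSite_lt_lastSite hN).ne'
  constructor
  · rintro rfl
    refine ⟨fun n h1 h2 => ?_, ?_, ?_⟩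
    · simp [endsConfig, h1, h2]
    · simp [endsConfig]
    · simp [endsConfig, hne]
  · rintro ⟨h, rfl, rfl⟩
    funext n
    rw [endsConfig]
    split_ifs with h1 h2
    · rw [h1]
    · rw [h2]
    · exact h n h1 h2

theorem endsState_eq (hN : 2 ≤ N) (C : Matrix (Fin 2) (Fin 2) ℂ) :
    endsState hN C = ∑ a, ∑ b, C a b • ket (endsConfig hN a b) := by
  funext x
  simp only [endsState, Finset.sum_apply, Pi.smul_apply, ket, Pi.single_apply, smul_eq_mul,
    eq_endsConfig_iff]
  by_cases h : ∀ n, n ≠ firstSite hN → n ≠ lastSite hN → x n = 0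
  · rw [if_pos h, Finset.sum_eq_single (x (firstSite hN)), Finset.sum_eq_single (x (lastSite hN))]
    · rw [if_pos ⟨h, rfl, rfl⟩, mul_one]
    · intro b _ hb; rw [if_neg fun h' => hb h'.2.2.symm, mul_zero]
    · simp
    · intro a _ ha
      exact Finset.sum_eq_zero fun b _ => by rw [if_neg fun h' => ha h'.2.1.symm, mul_zero]
    · simp
  · rw [if_neg h]
    exact (Finset.sum_eq_zero fun a _ => Finset.sum_eq_zero fun b _ => by
      rw [if_neg fun h' => h h'.1, mul_zero]).symm

theorem endsState_eq_wedgeList (hN : 2 ≤ N) (C : Matrix (Fin 2) (Fin 2) ℂ) :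
    endsState hN C = C 0 0 • wedgeList [] + C 0 1 • wedgeList [site (lastSite hN)]
      + C 1 0 • wedgeList [site (firstSite hN)]
      + C 1 1 • wedgeList [site (firstSite hN), site (lastSite hN)] := by
  have hlt := firstSite_lt_lastSite hN
  have key : ∀ (l : List (Fin N)) (a b : Fin 2), l.Pairwise (· < ·) →
      (∀ n, (if n ∈ l then 1 else 0) = endsConfig hN a b n) →
      wedgeList (l.map site) = ket (endsConfig hN a b) := by
    intro l a b hl h
    rw [wedgeList_site_of_pairwise l hl, funext h]
  have h00 := key [] 0 0 (by simp) (fun n => by simp [endsConfig])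
  have h01 := key [lastSite hN] 0 1 (by simp) (fun n => by
    by_cases h : n = firstSite hN
    · subst h; simp [endsConfig, hlt.ne]
    · simp [endsConfig, h])
  have h10 := key [firstSite hN] 1 0 (by simp) (fun n => by simp [endsConfig])
  have h11 := key [firstSite hN, lastSite hN] 1 1 (by simpa using hlt) (fun n => by
    by_cases h : n = firstSite hN
    · subst h; simp [endsConfig]
    · simp [endsConfig, h])
  simp only [List.map_cons, List.map_nil] at h00 h01 h10 h11
  rw [endsState_eq, Fin.sum_univ_two, Fin.sum_univ_two, Fin.sum_univ_two, h00, h01, h10, h11,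
    ← add_assoc]

theorem productState_plus_eq_endsState (hN : 2 ≤ N) :
    productState (fun n => if n = firstSite hN ∨ n = lastSite hN then qubitPlus else qubitZero)
      = endsState hN (Matrix.of fun _ _ => (1 / 2 : ℂ)) := by
  have hne := (firstSite_lt_lastSite hN).ne'
  have hplus : ∀ a, qubitPlus a = 1 / (Real.sqrt 2 : ℂ) := by
    intro a; fin_cases a <;> rfl
  have hzero : ∀ a, qubitZero a = if a = 0 then 1 else 0 := by
    intro a; fin_cases a <;> rfl
  funext x
  rw [productState, endsState, ← Finset.mul_prod_erase _ _ (Finset.mem_univ (firstSite hN)),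
    ← Finset.mul_prod_erase _ _ (Finset.mem_erase.2 ⟨hne, Finset.mem_univ (lastSite hN)⟩),
    if_pos (Or.inl rfl), if_pos (Or.inr rfl), hplus, hplus, ← mul_assoc]
  have h2 : 1 / (Real.sqrt 2 : ℂ) * (1 / (Real.sqrt 2 : ℂ)) = 1 / 2 := by
    rw [div_mul_div_comm, one_mul, ← Complex.ofReal_mul, Real.mul_self_sqrt (by norm_num)]
    norm_num
  have h3 : ∀ n ∈ (Finset.univ.erase (firstSite hN)).erase (lastSite hN),
      (if n = firstSite hN ∨ n = lastSite hN then qubitPlus else qubitZero) (x n)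
        = if x n = 0 then 1 else 0 := by
    intro n hn
    simp only [Finset.mem_erase] at hn
    rw [if_neg (by tauto), hzero]
  rw [h2, Finset.prod_congr rfl h3, Finset.prod_ite_zero, Finset.prod_const_one]
  simp only [mul_ite, mul_one, mul_zero]
  refine if_congr ⟨fun h n h1 h4 => h n ?_, fun h n hn => ?_⟩ rfl rfl
  · simp [h1, h4]
  · simp only [Finset.mem_erase] at hn
    exact h n hn.2.1 hn.1

theorem IsPerfectTransfer.entangle (h : IsPerfectTransfer hN J B t₀ φ) :
    evolution (hamiltonian J B) t₀ *ᵥ productState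
        (fun n => if n = firstSite hN ∨ n = lastSite hN then qubitPlus else qubitZero)
      = Complex.exp (Complex.I * t₀ * ∑ n, (B n : ℂ)) •
        endsState hN ((1 / 2 : ℂ) • !![1, Complex.exp (Complex.I * φ);
          Complex.exp (Complex.I * φ), -Complex.exp (Complex.I * φ) ^ 2]) := by
  have h' : evolution (hamiltonianOne J B) t₀ *ᵥ site (firstSite hN)
      = Complex.exp (Complex.I * φ) • site (lastSite hN) := h
  -- The two end excitations trade places; this exchange sign is the source of the entanglement.
  have hswap : wedgeList [site (lastSite hN), site (firstSite hN)]
      = -wedgeList [site (firstSite hN), site (lastSite hN)] := by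
    rw [wedgeList_pair, wedge_oneExcitation_comm, wedgeList_pair]
  have h1 := fun v : Fin N → ℂ => wedgeList_smul (Complex.exp (Complex.I * φ)) [v]
  have h2 := fun v w : Fin N → ℂ => wedgeList_smul (Complex.exp (Complex.I * φ)) [v, w]
  simp only [List.map_cons, List.map_nil, List.length_cons, List.length_nil, zero_add,
    pow_one] at h1 h2
  rw [productState_plus_eq_endsState, endsState_eq_wedgeList, endsState_eq_wedgeList]
  simp only [Matrix.mulVec_add, Matrix.mulVec_smul, evolution_mulVec_wedgeList, List.map_cons,
    List.map_nil, h', h.transfer_back, h1, h2, hswap]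
  simp only [Matrix.smul_apply, Matrix.of_apply, Matrix.cons_val', Matrix.cons_val_zero,
    Matrix.cons_val_one, Matrix.cons_val_fin_one, smul_eq_mul]
  module

/-- The rows have squared norm `1/2`, and the minus sign makes them orthogonal: `conj p - p * conj p
^ 2 = 0`. -/
theorem isMaximallyEntangled_of_phases {c p : ℂ} (hc : c * conj c = 1) (hp : p * conj p = 1) :
    IsMaximallyEntangled (c • ((1 / 2 : ℂ) • !![1, p; p, -p ^ 2])) := by
  have h2 : conj (2 : ℂ) = 2 := map_ofNat _ 2
  constructor <;> ext i j <;> fin_cases i <;> fin_cases j <;>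
    simp [Matrix.mul_apply, Fin.sum_univ_two, h2] <;> grind

/-! Dual-rail transfer. -/

theorem IsPerfectTransfer.evolution_apply (h : IsPerfectTransfer hN J B t₀ φ)
    (hJ : ∀ n, 0 ≤ J n * J n.rev) (z x : Config N) :
    evolution (hamiltonian J B) t₀ z x
      = if x = (fun n => z n.rev) then Complex.exp (Complex.I * t₀ * ∑ n, (B n : ℂ))
          * Complex.exp (Complex.I * φ) ^ weight x * (-1 : ℂ) ^ (weight x).choose 2 else 0 := by
  have h1 := congrFun (h.mirror_ket hJ x) z
  have h2 : z = (fun n => x n.rev) ↔ x = (fun n => z n.rev) := by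
    constructor <;> rintro rfl <;> simp
  simpa [ket, Pi.single_apply, h2] using h1

theorem weight_eq_sum (x : Config N) : weight x = ∑ n, if x n = 1 then 1 else 0 := by
  rw [← card_excited_eq_weight, Finset.card_filter]

theorem weight_eq_weight_tailBits (hN : 2 ≤ N) (x : Config N) :
    weight x = (if x (firstSite hN) = 1 then 1 else 0) + (if x (secondSite hN) = 1 then 1 else 0)
      + weight (tailBits x) := by
  -- In this form the first two summands can be split off, and `tailBits` is a double successor.
  obtain ⟨M, rfl⟩ : ∃ M, N = M + 2 := ⟨N - 2, by omega⟩
  rw [weight_eq_sum, weight_eq_sum, Fin.sum_univ_succ, Fin.sum_univ_succ, ← add_assoc]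
  rfl

theorem tailBits_rev (hN : 2 ≤ N) (z : Config N) :
    tailBits (fun n => z n.rev) = fun n => initBits z n.rev := by
  funext n
  simp only [tailBits, initBits]
  congr 1
  ext
  simp only [Fin.val_rev]
  omega

theorem IsPerfectTransfer.dualRail_transfer (h : IsPerfectTransfer hN J B t₀ φ)
    (hJ : ∀ n, 0 ≤ J n * J n.rev) (ρ : Op (N - 2)) (hρ : IsDensity ρ) :
    ∃ ρ' : Op (N - 2), IsDensity ρ' ∧ ∀ α β : ℂ,
      evolution (hamiltonian J B) t₀ * encodedAtStart hN (dualRail α β) ρ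
          * (evolution (hamiltonian J B) t₀)ᴴ
        = encodedAtEnd hN (dualRail α β) ρ' := by
  set p := Complex.exp (Complex.I * φ) with hp
  set c := Complex.exp (Complex.I * t₀ * ∑ n, (B n : ℂ)) with hc
  have hpp : p * conj p = 1 := exp_I_mul_conj φ
  have hcc : c * conj c = 1 := exp_I_mul_sum_mul_conj t₀ B
  let e : Config (N - 2) ≃ Config (N - 2) :=
    Function.Involutive.toPerm (fun y n => y n.rev) fun y => by simp
  -- The phase and sign due to the rest of the chain; `weight y + 1` counts the one excitation of
  -- the encoded pair, whose factor `p` is kept outside.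
  let η : Config (N - 2) → ℂ := fun y => p ^ weight y * (-1) ^ (weight y + 1).choose 2
  have hη : ∀ y, η y * conj (η y) = 1 := by
    intro y
    have h1 : (-1 : ℂ) ^ (weight y + 1).choose 2 * (-1 : ℂ) ^ (weight y + 1).choose 2 = 1 := by
      rw [← pow_add, ← two_mul, pow_mul]; simp
    simp only [η, map_mul, map_pow, map_neg, map_one]
    rw [mul_mul_mul_comm, h1, ← mul_pow, hpp, one_pow, one_mul]
  -- The mirrored state conjugated by a diagonal unitary: again a density operator, and independent
  -- of `α` and `β`.
  let ρ' : Op (N - 2) := Matrix.diagonal (fun y => η (e y)) * ρ.submatrix e e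
    * (Matrix.diagonal fun y => η (e y))ᴴ
  have hρ' : ∀ y y', ρ' y y' = η (e y) * conj (η (e y')) * ρ (e y) (e y') := by
    intro y y'
    simp only [ρ', Matrix.diagonal_conjTranspose, Matrix.mul_diagonal, Matrix.diagonal_mul,
      Matrix.submatrix_apply, Pi.star_apply, starRingEnd_apply]
    ring
  refine ⟨ρ', ⟨(hρ.1.submatrix e).mul_mul_conjTranspose_same _, ?_⟩, fun α β => ?_⟩
  · rw [← hρ.2, Matrix.trace, Matrix.trace, ← Equiv.sum_comp e ρ.diag]
    refine Finset.sum_congr rfl fun y _ => ?_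
    rw [Matrix.diag_apply, hρ', hη, one_mul, Matrix.diag_apply]
  · ext z z'
    have hsum : ∀ A : Op N, (evolution (hamiltonian J B) t₀ * A
        * (evolution (hamiltonian J B) t₀)ᴴ) z z'
        = evolution (hamiltonian J B) t₀ z (fun n => z n.rev)
          * A (fun n => z n.rev) (fun n => z' n.rev)
          * conj (evolution (hamiltonian J B) t₀ z' (fun n => z' n.rev)) := by
      intro A
      rw [Matrix.mul_apply, Finset.sum_eq_single (fun n => z' n.rev), Matrix.mul_apply,
        Finset.sum_eq_single (fun n => z n.rev), Matrix.conjTranspose_apply, starRingEnd_apply]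
      · intro x _ hx; rw [h.evolution_apply hJ, if_neg hx, zero_mul]
      · simp
      · intro x _ hx
        rw [Matrix.conjTranspose_apply, h.evolution_apply hJ, if_neg hx, star_zero, mul_zero]
      · simp
    -- The dual-rail amplitude vanishes unless exactly one of its two bits is set, which fixes the
    -- total weight in terms of the remaining bits.
    have hamp : ∀ w : Config N,
        evolution (hamiltonian J B) t₀ w (fun n => w n.rev)
            * dualRail α β (w (lastSite hN)) (w (nextToLastSite hN))
          = c * p * η (e (initBits w))
            * dualRail α β (w (lastSite hN)) (w (nextToLastSite hN)) := by
      intro w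
      have hw := weight_eq_weight_tailBits hN fun n => w n.rev
      rw [tailBits_rev hN, rev_firstSite, rev_secondSite] at hw
      rw [h.evolution_apply hJ, if_pos rfl, hw]
      change _ = c * p * (p ^ weight (fun n => initBits w n.rev)
        * (-1) ^ (weight (fun n => initBits w n.rev) + 1).choose 2) * _
      generalize w (lastSite hN) = a
      generalize w (nextToLastSite hN) = b
      generalize weight (fun n => initBits w n.rev) = k
      fin_cases a <;> fin_cases b <;> simp [dualRail, ← hp, ← hc, pow_add, add_comm 1 k] <;>
        (left; ring)
    have hz := hamp z
    have hz' := congrArg conj (hamp z')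
    simp only [map_mul] at hz'
    rw [hsum, encodedAtStart, encodedAtEnd, tailBits_rev hN, tailBits_rev hN, rev_firstSite,
      rev_secondSite, hρ']
    change _ * (_ * _ * ρ (e (initBits z)) (e (initBits z'))) * _ = _
    calc _ = (evolution (hamiltonian J B) t₀ z (fun n => z n.rev)
            * dualRail α β (z (lastSite hN)) (z (nextToLastSite hN)))
          * (conj (evolution (hamiltonian J B) t₀ z' (fun n => z' n.rev))
            * conj (dualRail α β (z' (lastSite hN)) (z' (nextToLastSite hN))))
          * ρ (e (initBits z)) (e (initBits z')) := by ring
      _ = (c * conj c) * (p * conj p) * (dualRail α β (z (lastSite hN)) (z (nextToLastSite hN))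
          * conj (dualRail α β (z' (lastSite hN)) (z' (nextToLastSite hN)))
          * (η (e (initBits z)) * conj (η (e (initBits z')))
            * ρ (e (initBits z)) (e (initBits z')))) := by rw [hz, hz']; ring
      _ = _ := by rw [hcc, hpp, one_mul, one_mul]

end PerfectTransfer

end SpinChain

end


theorem mainTheorem8 {N : ℕ} (J : Fin (N - 1) → ℝ) (B : Fin N → ℝ) :
    -- the single-excitation block
    (∀ a : Fin N → ℂ,
      hamiltonian J B *ᵥ oneExcitation a
        = oneExcitation (hamiltonianOne J B *ᵥ a)
          - (∑ n, (B n : ℂ)) • oneExcitation a) ∧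
    -- the Jordan-Wigner operators are fermionic, and turn the chain into a hopping Hamiltonian
    (∀ m n : Fin N,
      annihilate m * create n + create n * annihilate m
        = (if m = n then 1 else 0) ∧
      annihilate m * annihilate n
        + annihilate n * annihilate m = 0 ∧
      create m * create n + create n * create m = 0 ∧
      annihilate m *ᵥ vacuum N = 0) ∧
    hamiltonian J B
      = hamiltonianJW J B - (∑ n, (B n : ℂ)) • (1 : Op N) ∧
    -- diagonalization by independent fermionic modes, for every eigenbasis; there is one
    (∃ lam v, IsEigenbasis J B lam v) ∧
    (∀ lam v, IsEigenbasis J B lam v →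
      (∀ m n : Fin N,
        annihilateMode (v m).ofLp * createMode (v n).ofLp
          + createMode (v n).ofLp * annihilateMode (v m).ofLp
          = (if m = n then 1 else 0) ∧
        annihilateMode (v m).ofLp * annihilateMode (v n).ofLp
          + annihilateMode (v n).ofLp * annihilateMode (v m).ofLp = 0 ∧
        createMode (v m).ofLp * createMode (v n).ofLp
          + createMode (v n).ofLp * createMode (v m).ofLp = 0 ∧
        annihilateMode (v m).ofLp *ᵥ vacuum N = 0) ∧
      hamiltonianJW J B
        = ∑ n, (lam n : ℂ) •
            (createMode (v n).ofLp * annihilateMode (v n).ofLp) ∧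
      (∀ l : List (Fin N),
        hamiltonianJW J B *ᵥ wedgeList (l.map fun n => (v n).ofLp)
          = (l.map fun n => (lam n : ℂ)).sum •
              wedgeList (l.map fun n => (v n).ofLp))) ∧
    -- the wedge product: exchange, exclusion, normal ordering, creation operators
    (∀ a b : Fin N → ℂ,
      wedge (oneExcitation a) (oneExcitation b)
        = -wedge (oneExcitation b) (oneExcitation a) ∧
      wedge (oneExcitation a) (oneExcitation a) = 0) ∧
    (∀ x : Config N,
      wedgeList ((excitedSites x).map site) = ket x) ∧
    (∀ l : List (Fin N → ℂ),
      wedgeList l = (l.map createMode).prod *ᵥ vacuum N) ∧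
    -- evolution of two, and of any number of, excitations
    (∀ (t : ℝ) (a b : Fin N → ℂ),
      evolution (hamiltonian J B) t *ᵥ
          wedge (oneExcitation a) (oneExcitation b)
        = Complex.exp (Complex.I * t * ∑ n, (B n : ℂ)) •
          wedge
            (oneExcitation (evolution (hamiltonianOne J B) t *ᵥ a))
            (oneExcitation
              (evolution (hamiltonianOne J B) t *ᵥ b))) ∧
    (∀ (t : ℝ) (l : List (Fin N → ℂ)),
      evolution (hamiltonian J B) t *ᵥ wedgeList l
        = Complex.exp (Complex.I * t * ∑ n, (B n : ℂ)) •
          wedgeList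
            (l.map fun a => evolution (hamiltonianOne J B) t *ᵥ a)) ∧
    -- perfect transfer chains
    (∀ (hN : 2 ≤ N) (t₀ φ : ℝ), IsPerfectTransfer hN J B t₀ φ →
      -- entanglement generation
      (evolution (hamiltonian J B) t₀ *ᵥ
          productState (fun n => if n = firstSite hN ∨ n = lastSite hN
            then qubitPlus else qubitZero)
        = Complex.exp (Complex.I * t₀ * ∑ n, (B n : ℂ)) •
          endsState hN
            ((1 / 2 : ℂ) • !![1, Complex.exp (Complex.I * φ);
              Complex.exp (Complex.I * φ), -Complex.exp (Complex.I * φ) ^ 2]) ∧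
      IsMaximallyEntangled
        (Complex.exp (Complex.I * t₀ * ∑ n, (B n : ℂ)) •
          ((1 / 2 : ℂ) • !![1, Complex.exp (Complex.I * φ);
            Complex.exp (Complex.I * φ), -Complex.exp (Complex.I * φ) ^ 2]))) ∧
      ((∀ n, 0 ≤ J n * J n.rev) →
        -- mirroring of multi-excitation states
        (∀ l : List (Fin N),
          evolution (hamiltonian J B) t₀ *ᵥ
              wedgeList (l.map site)
            = (Complex.exp (Complex.I * t₀ * ∑ n, (B n : ℂ))
                * Complex.exp (Complex.I * φ) ^ l.length) •
              wedgeList (l.map fun n => site n.rev)) ∧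
        (∀ x : Config N,
          evolution (hamiltonian J B) t₀ *ᵥ ket x
            = (Complex.exp (Complex.I * t₀ * ∑ n, (B n : ℂ))
                * Complex.exp (Complex.I * φ) ^ weight x
                * (-1 : ℂ) ^ (weight x).choose 2) •
              ket (fun n => x n.rev)) ∧
        -- dual-rail transfer with the rest of the chain in a basis state
        (∀ (α β : ℂ) (x : Config N),
          x (firstSite hN) = 0 → x (secondSite hN) = 0 →
          evolution (hamiltonian J B) t₀ *ᵥ
              wedge
                (oneExcitation (α • site (firstSite hN)
                  + β • site (secondSite hN)))
                (ket x)
            = (Complex.exp (Complex.I * t₀ * ∑ n, (B n : ℂ))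
                * Complex.exp (Complex.I * φ) ^ (weight x + 1)
                * (-1 : ℂ) ^ (weight x).choose 2) •
              wedge
                (oneExcitation (α • site (lastSite hN)
                  + β • site (nextToLastSite hN)))
                (ket (fun n => x n.rev)) ∧
          wedge
              (oneExcitation (α • site (lastSite hN)
                + β • site (nextToLastSite hN)))
              (ket (fun n => x n.rev))
            = (-1 : ℂ) ^ weight x •
              wedge (ket (fun n => x n.rev))
                (oneExcitation (α • site (lastSite hN)
                  + β • site (nextToLastSite hN)))) ∧
        -- dual-rail transfer with the rest of the chain in an arbitrary mixed state
        (∀ ρ : Op (N - 2), IsDensity ρ →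
          ∃ ρ' : Op (N - 2), IsDensity ρ' ∧ ∀ α β : ℂ,
            evolution (hamiltonian J B) t₀
                * encodedAtStart hN (dualRail α β) ρ
                * (evolution (hamiltonian J B) t₀)ᴴ
              = encodedAtEnd hN (dualRail α β) ρ'))) := by

  refine ⟨fun a => ?_, fun m n => ⟨annihilate_anticomm_create m n, annihilate_anticomm m n,
    create_anticomm m n, annihilate_mulVec_vacuum m⟩, hamiltonian_eq J B, exists_isEigenbasis J B,
    fun lam v hv => ⟨fun m n => ⟨?_, annihilateMode_anticomm _ _, createMode_anticomm _ _,
      annihilateMode_mulVec_vacuum _⟩, ?_, fun l => ?_⟩,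
    fun a b => ⟨wedge_oneExcitation_comm a b, wedge_oneExcitation_self a⟩,
    wedgeList_excitedSites, wedgeList_eq, fun t a b => ?_, evolution_mulVec_wedgeList J B,
    fun hN t₀ φ h => ⟨⟨h.entangle, ?_⟩, fun hJ => ⟨h.mirror_wedgeList hJ, h.mirror_ket hJ,
      fun α β x _ _ => ⟨h.mirror_wedge_ket hJ α β x, ?_⟩, h.dualRail_transfer hJ⟩⟩⟩
  · rw [hamiltonian_eq, hamiltonianJW_eq, Matrix.sub_mulVec, Matrix.smul_mulVec, Matrix.one_mulVec,
      secondQuantization_mulVec_oneExcitation]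
  · rw [annihilateMode_anticomm_createMode, orthonormalBasis_sum_conj_mul]
    split_ifs <;> simp
  · rw [hamiltonianJW_eq, eq_sum_vecMulVec_of_eigenbasis _ (fun n => (lam n : ℂ)) v hv,
      secondQuantization_sum]
    simp only [secondQuantization_smul, secondQuantization_vecMulVec]
  · rw [hamiltonianJW_eq]
    exact secondQuantization_mulVec_wedgeList _ (fun n => (lam n : ℂ)) (fun n => (v n).ofLp) hv l
  · rw [← wedgeList_pair, evolution_mulVec_wedgeList, List.map_cons, List.map_singleton,
      wedgeList_pair]
  · refine isMaximallyEntangled_of_phases ?_ (exp_I_mul_conj φ)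
    exact exp_I_mul_sum_mul_conj t₀ B
  · rw [wedge_oneExcitation_ket, weight_rev]
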